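/- \textbf{Setting.} Let $\mathcal{RH}_\infty=\mathcal{RH}_2$ be the set of proper real-rational transfer functions in $z$ all of whose poles lie in $|z|<1$. Let $\mathbb H\in\mathcal{RH}_2$, not necessarily minimum phase, with $\mathbb S_w(e^{j\theta})=|\mathbb H(e^{j\theta})|^2>0$ for all $\theta$, and let $P\ge 0$. Consider the channel $Y_t=U_t+W_t$ where $W$ is the output of $\mathbb H$ driven by white Gaussian noise of zero mean and unit variance. A 2-dof controller is a pair $[\mathbb K_v,\mathbb K]$ of real-rational transfer functions, acting by $U=\mathbb K_vV+\mathbb KY$; it is \emph{stabilising} if the loop around the plant $\mathbb F=1$ (from $U$ to $Y$) is well posed ($1-\mathbb K\neq 0$) and all closed-loop transfer functions, from the exogenous input and from disturbances at the plant input and output to $U$ and $Y$, lie in $\mathcal{RH}_\infty$. (Equivalently, $[\mathbb K_v,\mathbb K]=(1+\mathbb Q)^{-1}[\mathbb Q_v,\mathbb Q]$ with Youla parameters $\mathbb Q_v,\mathbb Q\in\mathcal{RH}_\infty$, $1+\mathbb Q\ne0$.) It is \emph{strictly causal} if its feedback part $\mathbb K$ is strictly proper (equivalently, $\mathbb Q$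 is strictly proper). A \emph{power spectral density} is a nonnegative, even, integrable function $\mathbb S_v$ of $\theta\in[-\pi,\pi]$. The exogenous input $V$ is a zero-mean stationary Gaussian process with power spectral density $\mathbb S_v$, independent of $W$. The closed-loop signals are the stationary (steady-state) ones, $U=(1-\mathbb K)^{-1}(\mathbb KW+\mathbb K_vV)$ and $Y=U+W$, indexed by $t\in\mathbb Z$. The directed information rate is $\lim_{T\to\infty}\frac1T I(U^T\to Y^T)$, where $I(U^T\to Y^T)=\sum_{i=1}^T I(U^i;Y_i\mid Y^{i-1})$, $U^i=(U_1,\dots,U_i)$, $Y^{i-1}=(Y_1,\dots,Y_{i-1})$, in bits, and the average channel input power is $\lim_{T\to\infty}\frac1T\sum_{t=1}^T E[U_t^2]$. \textbf{Theorem.} For every strictly causal stabilising controller and every power spectral density $\mathbb S_v$ the directed information $I(U^T\to Y^T)$ is finite for every $T$, and the directed information rate and the average channel input power exist, are finite, and depend only on $\mathbb H$, the controller and $\mathbb S_v$. The supremum of the directed information rates over all strictly causal stabilising controllers and all $\mathbb S_v$ with average channel input power at most $P$ is finite and equals the value of $$ \begin{aligned} \sup_{\mathbb S_v,\mathbb Q}\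 &\frac1{2\pi}\int_{-\pi}^{\pi}\frac12\log_2\!\left(\frac{\mathbb S_v(e^{j\theta})}{\mathbb S_w(e^{j\theta})}+|1+\mathbb Q(e^{j\theta})|^2\right)d\theta\\ \text{s.t. }\ &\frac1{2\pi}\int_{-\pi}^{\pi}\Big(\mathbb S_v(e^{j\theta})+|\mathbb Q(e^{j\theta})|^2\,\mathbb S_w(e^{j\theta})\Big)d\theta\le P,\\ &\mathbb S_v\ge 0 \text{ a power spectral density},\qquad \mathbb Q\in\mathcal{RH}_2 \text{ strictly proper (strictly causal)}, \end{aligned} $$ and one of the two suprema is attained if and only if the other is. -/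

import Mathlib

open MeasureTheory ProbabilityTheory Filter Topology
open scoped ENNReal

noncomputable section

namespace FeedbackCapacity

/-! ### Real-rational transfer functions in the variable `z` -/

/-- A real-rational transfer function is proper (causal). -/
def IsProper (G : RatFunc ℝ) : Prop := G.num.degree ≤ G.denom.degree

/-- A real-rational transfer function is strictly proper (strictly causal), i.e. `G(∞) = 0`. -/
def IsStrictlyProper (G : RatFunc ℝ) : Prop := G.num.degree < G.denom.degree

/-- `G ∈ RH₂ = RH∞`: `G` is proper, and all its poles (the complex zeros of the denominator of its
reduced fraction) lie strictly inside the unit disc. -/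
def IsRHInfty (G : RatFunc ℝ) : Prop :=
  IsProper G ∧ ∀ z : ℂ, Polynomial.aeval z G.denom = 0 → ‖z‖ < 1

/-- The value `G(z)` at a complex number `z`. -/
def evalAt (G : RatFunc ℝ) (z : ℂ) : ℂ := RatFunc.eval (algebraMap ℝ ℂ) z G

/-- The frequency response `G(e^{jθ})`. -/
def freqResp (G : RatFunc ℝ) (θ : ℝ) : ℂ := evalAt G (Complex.exp (θ * Complex.I))

/-- The sequence `g` is the impulse response of `G`: its `z`-transform `∑ g_k z^{-k}` converges to
`G(z)` on `|z| ≥ 1`. -/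
def IsImpulseResponse (G : RatFunc ℝ) (g : ℕ → ℝ) : Prop :=
  ∀ z : ℂ, 1 ≤ ‖z‖ → HasSum (fun k : ℕ => (g k : ℂ) * (z ^ k)⁻¹) (evalAt G z)

/-- The two-degree-of-freedom controller `[Kv, K]`, `u = Kv v + K y`, stabilises the closed loop
(positive feedback) around the plant `F`. With a disturbance `d` at the plant input and a
disturbance `w` at the plant output, the loop equations
`u = Kv v + K y + d`, `y = F u + w` are uniquely solvable, and every closed-loop transfer function
from `(v, w, d)` to `(u, y)` belongs to `RH∞`. -/
structure IsStabilizing (F Kv K : RatFunc ℝ) : Prop where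
  wellPosed : 1 - F * K ≠ 0
  v_to_u : IsRHInfty (Kv / (1 - F * K))
  w_to_u : IsRHInfty (K / (1 - F * K))
  d_to_u : IsRHInfty (1 / (1 - F * K))
  v_to_y : IsRHInfty (F * Kv / (1 - F * K))
  w_to_y : IsRHInfty (1 / (1 - F * K))
  d_to_y : IsRHInfty (F / (1 - F * K))

/-! ### Processes indexed by `ℤ` -/

section Processes

variable {Ω : Type*} [MeasurableSpace Ω]

/-- White Gaussian noise with zero mean and unit variance. -/
structure IsWhiteGaussian (Z : ℤ → Ω → ℝ) (μ : Measure Ω) : Prop where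
  measurable : ∀ t, Measurable (Z t)
  law : ∀ t, μ.map (Z t) = gaussianReal 0 1
  indep : iIndepFun Z μ

/-- `Y` is the output of the system `G` driven by `X`: `Y_t = ∑_{k ≥ 0} g_k X_{t-k}` in mean
square, where `g` is the impulse response of `G`. -/
def IsOutput (G : RatFunc ℝ) (X Y : ℤ → Ω → ℝ) (μ : Measure Ω) : Prop :=
  (∀ t, Measurable (Y t)) ∧ ∃ g : ℕ → ℝ, IsImpulseResponse G g ∧ ∀ t : ℤ,
    Tendsto (fun N : ℕ =>
      eLpNorm (fun ω => Y t ω - ∑ k ∈ Finset.range N, g k * X (t - k) ω) 2 μ) atTop (𝓝 0)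

/-- `S`, as a function of the angle `θ ∈ [-π, π]`, is the power spectral density of a real
stationary process: nonnegative, even and integrable. -/
structure IsPSD (S : ℝ → ℝ) : Prop where
  nonneg : ∀ θ ∈ Set.Icc (-Real.pi) Real.pi, 0 ≤ S θ
  even : ∀ θ ∈ Set.Icc (-Real.pi) Real.pi, S (-θ) = S θ
  integrable : IntervalIntegrable S volume (-Real.pi) Real.pi

/-- `V` is a zero-mean stationary Gaussian process with power spectral density `S`, that is,
`E[V_s V_t] = (1/2π) ∫_{-π}^{π} S(θ) e^{j(t-s)θ} dθ` (and `S` is even). -/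
structure IsStationaryGaussian (S : ℝ → ℝ) (V : ℤ → Ω → ℝ) (μ : Measure Ω) : Prop where
  measurable : ∀ t, Measurable (V t)
  gaussian : IsGaussianProcess V μ
  mean : ∀ t, ∫ ω, V t ω ∂μ = 0
  cov : ∀ s t : ℤ, ∫ ω, V s ω * V t ω ∂μ =
    (1 / (2 * Real.pi)) *
      ∫ θ in (-Real.pi)..Real.pi, S θ * Real.cos (((t : ℝ) - (s : ℝ)) * θ)

/-- The steady-state signals of the channel `Y = U + W` in closed loop with the controller
`U = Kv V + K Y`. The noise `W` is the output of `H` driven by white Gaussian noise, the exogenous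
input `V` is stationary Gaussian with power spectral density `Sv` and independent of `W`, and
`U` is the response `(1 - K)⁻¹ (K W + Kv V)` of the loop. -/
structure IsClosedLoop (H Kv K : RatFunc ℝ) (Sv : ℝ → ℝ) (W V U Y : ℤ → Ω → ℝ)
    (μ : Measure Ω) : Prop where
  measurable_U : ∀ t, Measurable (U t)
  measurable_Y : ∀ t, Measurable (Y t)
  noise : ∃ Z : ℤ → Ω → ℝ, IsWhiteGaussian Z μ ∧ IsOutput H Z W μ
  exogenous : IsStationaryGaussian Sv V μ
  indep : IndepFun (fun ω t => W t ω) (fun ω t => V t ω) μ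
  input : ∃ A B : ℤ → Ω → ℝ, IsOutput (K / (1 - K)) W A μ ∧ IsOutput (Kv / (1 - K)) V B μ ∧
    ∀ t, U t =ᵐ[μ] fun ω => A t ω + B t ω
  channel : ∀ t, Y t =ᵐ[μ] fun ω => U t ω + W t ω

/-! ### Directed information -/

/-- Conditional mutual information `I(X; Y | Z)` in bits: the Kullback-Leibler divergence of the
joint law from the law under which `X` and `Y` are conditionally independent given `Z`. -/
def condMutualInfo {α β γ : Type*} [MeasurableSpace α] [StandardBorelSpace α] [Nonempty α]
    [MeasurableSpace β] [StandardBorelSpace β] [Nonempty β] [MeasurableSpace γ]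
    (X : Ω → α) (Y : Ω → β) (Z : Ω → γ) (μ : Measure Ω) [IsFiniteMeasure μ] : ℝ≥0∞ :=
  InformationTheory.klDiv (μ.map fun ω => (Z ω, X ω, Y ω))
    ((μ.map Z).compProd (Kernel.prod (condDistrib X Z μ) (condDistrib Y Z μ)))
    / ENNReal.ofReal (Real.log 2)

/-- The block `X^n = (X_1, …, X_n)`. -/
def block (X : ℤ → Ω → ℝ) (n : ℕ) : Ω → (Fin n → ℝ) := fun ω i => X ((i : ℤ) + 1) ω

/-- Directed information `I(U^T → Y^T) = ∑_{i=1}^T I(U^i; Y_i | Y^{i-1})` in bits. -/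
def directedInfo (U Y : ℤ → Ω → ℝ) (μ : Measure Ω) [IsFiniteMeasure μ] (T : ℕ) : ℝ≥0∞ :=
  ∑ n ∈ Finset.range T, condMutualInfo (block U (n + 1)) (Y ((n : ℤ) + 1)) (block Y n) μ

/-- `R = lim_{T → ∞} I(U^T → Y^T) / T`, all the directed informations being finite. -/
def HasDirectedInfoRate (U Y : ℤ → Ω → ℝ) (μ : Measure Ω) [IsFiniteMeasure μ] (R : ℝ) : Prop :=
  (∀ T, directedInfo U Y μ T ≠ ∞) ∧
    Tendsto (fun T : ℕ => (directedInfo U Y μ T).toReal / T) atTop (𝓝 R)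

/-- `p = lim_{T → ∞} (1/T) ∑_{t=1}^T E[U_t²]`, all the second moments being finite. -/
def HasAveragePower (U : ℤ → Ω → ℝ) (μ : Measure Ω) (p : ℝ) : Prop :=
  (∀ t, MemLp (U t) 2 μ) ∧
    Tendsto (fun T : ℕ => (∑ n ∈ Finset.range T, ∫ ω, U ((n : ℤ) + 1) ω ^ 2 ∂μ) / T) atTop (𝓝 p)

end Processes

/-! ### The two optimisation problems -/

/-- The directed information rates (bits per channel use) over the channel `Y = U + W` with noise
filter `H`, for all controllers `[Kv, K]` with strictly causal feedback `K` that stabilise the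
loop (the plant from `U` to `Y` being `1`) and all exogenous inputs, with average channel input
power at most `P`. -/
def directedInfoRates (H : RatFunc ℝ) (P : ℝ) : Set ℝ :=
  {R | ∃ (Kv K : RatFunc ℝ) (Sv : ℝ → ℝ), IsStabilizing 1 Kv K ∧ IsStrictlyProper K ∧ IsPSD Sv ∧
    ∃ (Ω : Type) (_ : MeasurableSpace Ω) (μ : Measure Ω) (_ : IsProbabilityMeasure μ)
      (W V U Y : ℤ → Ω → ℝ), IsClosedLoop H Kv K Sv W V U Y μ ∧
        (∃ p ≤ P, HasAveragePower U μ p) ∧ HasDirectedInfoRate U Y μ R}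

/-- Noise power spectral density `S_w(e^{jθ}) = |H(e^{jθ})|²`. -/
def noisePSD (H : RatFunc ℝ) (θ : ℝ) : ℝ := ‖freqResp H θ‖ ^ 2

/-- The objective
`(1/2π) ∫_{-π}^{π} (1/2) log₂ (S_v(e^{jθ}) / S_w(e^{jθ}) + |1 + Q(e^{jθ})|²) dθ`. -/
def objective (H : RatFunc ℝ) (Sv : ℝ → ℝ) (Q : RatFunc ℝ) : ℝ :=
  (1 / (2 * Real.pi)) * ∫ θ in (-Real.pi)..Real.pi,
    (1 / 2) * Real.logb 2 (Sv θ / noisePSD H θ + ‖1 + freqResp Q θ‖ ^ 2)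

/-- The power `(1/2π) ∫_{-π}^{π} (S_v(e^{jθ}) + |Q(e^{jθ})|² S_w(e^{jθ})) dθ`. -/
def inputPower (H : RatFunc ℝ) (Sv : ℝ → ℝ) (Q : RatFunc ℝ) : ℝ :=
  (1 / (2 * Real.pi)) * ∫ θ in (-Real.pi)..Real.pi,
    (Sv θ + ‖freqResp Q θ‖ ^ 2 * noisePSD H θ)

/-- The values of the objective at the feasible points of the feedback capacity problem. -/
def capacityValues (H : RatFunc ℝ) (P : ℝ) : Set ℝ :=
  {R | ∃ (Sv : ℝ → ℝ) (Q : RatFunc ℝ), IsPSD Sv ∧ IsRHInfty Q ∧ IsStrictlyProper Q ∧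
    inputPower H Sv Q ≤ P ∧ R = objective H Sv Q}

end FeedbackCapacity

end

/-! With Q = K/(1-K) and Qv = Kv/(1-K), the closed loop is U = QW + Qv V and Y = (1+Q)W + Qv V, so
Qv V matters only through its spectral density |Qv|² S_v, and the input power is `inputPower` at
that density.

All signals lie in one Gaussian subspace of L², where conditioning is orthogonal projection
(`exists_regression`). Each term I(U^{n+1}; Y_{n+1} | Y^n) is therefore half the binary logarithm of
a ratio of squared distances from Y_{n+1}: to the span of Y^n over that to the span of Y^n and
U^{n+1} (`condMutualInfo_regression`). The numerator tends to the one-step prediction error of Y. In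
the denominator the inputs are known, so the past of W since time 1 is known; as the feedback part
of U is a function of the strict past of W and the rest is orthogonal to W, nothing better is known,
and the limit is the prediction error of W (`HasSpectrum.tendsto_infDist_sq_feedback`).

By Szegő's theorem a one-step prediction error is the geometric mean of the spectral density
(`IsRegularPSD.geomMean_le`, `IsRegularPSD.exists_polynomial_integral_lt`). Cesàro averaging gives
the rate as half the logarithm of a ratio of geometric means, which is the objective
(`objective_eq`, `IsClosedLoop.hasRate`). Only |H|² enters, so the phase of H is irrelevant.

Conversely a feasible pair (S_v, Q) is realised by the Youla parameters [1, Q] and a closed loop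
built from an isonormal Gaussian process (`exists_isClosedLoop`). Hence the set of rates equals the
set of objective values; it is bounded by the arithmetic-geometric mean inequality. -/

namespace FeedbackCapacity

open scoped NNReal
open InformationTheory

/-! ### Conditional mutual information of Gaussian regressions -/

section Information

/-- The log-likelihood ratio is `l` almost everywhere, and the mass correction in `klDiv` cancels
because both measures have mass one. -/
lemma klDiv_withDensity_exp {α : Type*} [MeasurableSpace α] {μ ν : Measure α}
    [IsProbabilityMeasure μ] [IsProbabilityMeasure ν] {l : α → ℝ} (hl : Measurable l)
    (hμ : μ = ν.withDensity fun x => ENNReal.ofReal (Real.exp (l x))) (hint : Integrable l μ) :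
    klDiv μ ν = ENNReal.ofReal (∫ x, l x ∂μ) := by
  have hac : μ ≪ ν := by rw [hμ]; exact withDensity_absolutelyContinuous _ _
  have hllr : llr μ ν =ᵐ[μ] l := by
    have h : μ.rnDeriv ν =ᵐ[ν] fun x => ENNReal.ofReal (Real.exp (l x)) := by
      conv_lhs => rw [hμ]
      exact Measure.rnDeriv_withDensity ν (by fun_prop)
    filter_upwards [hac.ae_le h] with x hx
    rw [llr, hx, ENNReal.toReal_ofReal (Real.exp_pos _).le, Real.log_exp]
  rw [klDiv_of_ac_of_integrable hac (hint.congr hllr.symm), integral_congr_ae hllr]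
  simp

variable {Ω : Type*} [MeasurableSpace Ω] {μ : Measure Ω} [IsProbabilityMeasure μ]
  {α γ : Type*} [MeasurableSpace α] [MeasurableSpace γ]

/-- The law of `Z` and of `Y = M(Z) + ε` with `ε` Gaussian and independent of `Z`. -/
lemma lintegral_regression {Z : Ω → γ} {Y : Ω → ℝ} {M : γ → ℝ} {r : ℝ≥0}
    (hZ : Measurable Z) (hY : Measurable Y) (hM : Measurable M)
    (hind : IndepFun Z (fun ω => Y ω - M (Z ω)) μ)
    (hlaw : μ.map (fun ω => Y ω - M (Z ω)) = gaussianReal 0 r)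
    {f : γ × ℝ → ℝ≥0∞} (hf : Measurable f) :
    ∫⁻ ω, f (Z ω, Y ω) ∂μ
      = ∫⁻ z, ∫⁻ e, f (z, M z + e) ∂(gaussianReal 0 r) ∂(μ.map Z) := by
  have hε : Measurable (fun ω => Y ω - M (Z ω)) := by fun_prop
  rw [indepFun_iff_map_prod_eq_prod_map_map hZ.aemeasurable hε.aemeasurable, hlaw] at hind
  have hg : Measurable fun p : γ × ℝ => f (p.1, M p.1 + p.2) := by fun_prop
  have := lintegral_prod (μ := μ.map Z) (ν := gaussianReal 0 r) _ hg.aemeasurable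
  rw [← hind, lintegral_map hg (by fun_prop)] at this
  simpa using this

/-- The Gaussian kernel `z ↦ N(M(z), r)`. -/
noncomputable def regressionKernel (M : γ → ℝ) (r : ℝ≥0) : Kernel γ ℝ :=
  (Kernel.prod Kernel.id (Kernel.const γ (gaussianReal 0 r))).map fun p => M p.1 + p.2

lemma lintegral_regressionKernel {M : γ → ℝ} (hM : Measurable M) (r : ℝ≥0) (z : γ)
    {f : ℝ → ℝ≥0∞} (hf : Measurable f) :
    ∫⁻ y, f y ∂(regressionKernel M r z) = ∫⁻ e, f (M z + e) ∂(gaussianReal 0 r) := by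
  have hm : Measurable fun p : γ × ℝ => M p.1 + p.2 := by fun_prop
  rw [regressionKernel, Kernel.lintegral_map _ hm _ hf,
    Kernel.lintegral_prod _ _ _ (by fun_prop)]
  simp only [Kernel.id_apply, Kernel.const_apply]
  rw [lintegral_dirac']
  exact (hf.comp hm).lintegral_prod_right'

instance {M : γ → ℝ} {r : ℝ≥0} : IsFiniteKernel (regressionKernel M r) := by
  unfold regressionKernel; infer_instance

/-- Conditioning fixes M(Z) and leaves the independent residual untouched; uniqueness of the
disintegration identifies the kernel. -/
lemma condDistrib_regression {Z : Ω → γ} {Y : Ω → ℝ} {M : γ → ℝ} {r : ℝ≥0}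
    (hZ : Measurable Z) (hY : Measurable Y) (hM : Measurable M)
    (hind : IndepFun Z (fun ω => Y ω - M (Z ω)) μ)
    (hlaw : μ.map (fun ω => Y ω - M (Z ω)) = gaussianReal 0 r) :
    condDistrib Y Z μ =ᵐ[μ.map Z] regressionKernel M r := by
  refine condDistrib_ae_eq_of_measure_eq_compProd Z hY.aemeasurable ?_
  refine Measure.ext_of_lintegral _ fun f hf => ?_
  rw [lintegral_map hf (by fun_prop), Measure.lintegral_compProd hf,
    lintegral_regression hZ hY hM hind hlaw hf]
  refine lintegral_congr fun z => ?_
  rw [lintegral_regressionKernel hM r z (by fun_prop)]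

lemma lintegral_gaussianReal_add {r : ℝ≥0} (hr : r ≠ 0) (m : ℝ) {f : ℝ → ℝ≥0∞}
    (hf : Measurable f) :
    ∫⁻ e, f (m + e) ∂(gaussianReal 0 r) = ∫⁻ y, gaussianPDF 0 r (y - m) * f y := by
  rw [gaussianReal_of_var_ne_zero 0 hr,
    lintegral_withDensity_eq_lintegral_mul _ (measurable_gaussianPDF 0 r) (by fun_prop),
    ← lintegral_sub_right_eq_self _ m]
  simp

/-- Two points x and y are needed because two regressions of the same variable leave two different
residuals. -/
lemma gaussianPDF_mul_exp {r s : ℝ≥0} (hr : r ≠ 0) (hs : s ≠ 0) (x y : ℝ) :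
    gaussianPDF 0 s x = gaussianPDF 0 r y * ENNReal.ofReal (Real.exp
      (1 / 2 * Real.log (r / s) - x ^ 2 / (2 * s) + y ^ 2 / (2 * r))) := by
  have hr' : (0 : ℝ) < r := by positivity
  have hs' : (0 : ℝ) < s := by positivity
  rw [gaussianPDF, gaussianPDF, ← ENNReal.ofReal_mul (gaussianPDFReal_nonneg _ _ _)]
  congr 1
  simp only [gaussianPDFReal, sub_zero]
  have h1 : Real.exp (1 / 2 * Real.log (r / s) - x ^ 2 / (2 * s) + y ^ 2 / (2 * r))
      = Real.sqrt (r / s) * Real.exp (-x ^ 2 / (2 * s)) * Real.exp (y ^ 2 / (2 * r)) := by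
    rw [← Real.exp_log (Real.sqrt_pos.2 (div_pos hr' hs')), ← Real.exp_add, ← Real.exp_add,
      Real.log_sqrt (div_pos hr' hs').le]
    congr 1; ring
  have h2 : Real.exp (-y ^ 2 / (2 * r)) * Real.exp (y ^ 2 / (2 * r)) = 1 := by
    rw [← Real.exp_add, neg_div, neg_add_cancel, Real.exp_zero]
  have h3 : (Real.sqrt (2 * Real.pi * r))⁻¹ * Real.sqrt (r / s)
      = (Real.sqrt (2 * Real.pi * s))⁻¹ := by
    rw [← Real.sqrt_inv, ← Real.sqrt_mul (by positivity), ← Real.sqrt_inv]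
    congr 1; field_simp
  rw [h1, ← h3]
  linear_combination -((Real.sqrt (2 * Real.pi * r))⁻¹ * Real.sqrt (r / s)
    * Real.exp (-x ^ 2 / (2 * s))) * h2

variable [StandardBorelSpace α] [Nonempty α]

/-- In the reference law Y is redrawn given Z alone, so its Gaussian kernel does not see X; the
reference law becomes as explicit as the joint one. -/
lemma lintegral_compProd_condDistrib {Z : Ω → γ} {X : Ω → α} {Y : Ω → ℝ} {M : γ → ℝ} {r : ℝ≥0}
    (hZ : Measurable Z) (hX : Measurable X) (hY : Measurable Y) (hM : Measurable M)
    (hind : IndepFun Z (fun ω => Y ω - M (Z ω)) μ)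
    (hlaw : μ.map (fun ω => Y ω - M (Z ω)) = gaussianReal 0 r)
    {f : γ × α × ℝ → ℝ≥0∞} (hf : Measurable f) :
    ∫⁻ p, f p ∂((μ.map Z).compProd (Kernel.prod (condDistrib X Z μ) (condDistrib Y Z μ)))
      = ∫⁻ q, ∫⁻ e, f (q.1, q.2, M q.1 + e) ∂(gaussianReal 0 r)
          ∂(μ.map fun ω => (Z ω, X ω)) := by
  have hm : Measurable fun q : γ × α =>
      ∫⁻ e, f (q.1, q.2, M q.1 + e) ∂(gaussianReal 0 r) := by
    have : Measurable fun t : (γ × α) × ℝ => f (t.1.1, t.1.2, M t.1.1 + t.2) := by fun_prop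
    exact this.lintegral_prod_right'
  rw [← compProd_map_condDistrib hX.aemeasurable, Measure.lintegral_compProd hf,
    Measure.lintegral_compProd hm]
  refine lintegral_congr_ae ?_
  filter_upwards [condDistrib_regression hZ hY hM hind hlaw] with z hz
  rw [Kernel.lintegral_prod _ _ _ (by fun_prop)]
  refine lintegral_congr fun x => ?_
  rw [hz, lintegral_regressionKernel hM r z (by fun_prop)]

/-- The conditional mutual information `I(X; Y | Z)` when `Y` has Gaussian regressions on `Z` and
on `(Z, X)` with residual variances `r` and `s`. -/
theorem condMutualInfo_regression {Z : Ω → γ} {X : Ω → α} {Y : Ω → ℝ} {M : γ → ℝ}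
    {M' : γ × α → ℝ} {r s : ℝ≥0} (hr : r ≠ 0) (hs : s ≠ 0)
    (hZ : Measurable Z) (hX : Measurable X) (hY : Measurable Y) (hM : Measurable M)
    (hM' : Measurable M')
    (hind : IndepFun Z (fun ω => Y ω - M (Z ω)) μ)
    (hlaw : μ.map (fun ω => Y ω - M (Z ω)) = gaussianReal 0 r)
    (hind' : IndepFun (fun ω => (Z ω, X ω)) (fun ω => Y ω - M' (Z ω, X ω)) μ)
    (hlaw' : μ.map (fun ω => Y ω - M' (Z ω, X ω)) = gaussianReal 0 s) :
    condMutualInfo X Y Z μ = ENNReal.ofReal (1 / 2 * Real.logb 2 (r / s)) := by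
  have hr' : (0 : ℝ) < r := by positivity
  have hs' : (0 : ℝ) < s := by positivity
  -- The candidate log-density of the joint law against the reference law: the N(M'(z,x), s) density
  -- of y over its N(M(z), r) density.
  set l : γ × α × ℝ → ℝ := fun p => 1 / 2 * Real.log (r / s)
    - (p.2.2 - M' (p.1, p.2.1)) ^ 2 / (2 * s) + (p.2.2 - M p.1) ^ 2 / (2 * r) with hl
  have hlm : Measurable l := by fun_prop
  have hT : Measurable fun ω => (Z ω, X ω, Y ω) := by fun_prop
  have hsq : ∀ {v : ℝ≥0} {e : Ω → ℝ}, Measurable e → μ.map e = gaussianReal 0 v →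
      Integrable (fun ω => e ω ^ 2) μ ∧ ∫ ω, e ω ^ 2 ∂μ = v := by
    intro v e he hlaw
    have h1 : Integrable (fun x : ℝ => x ^ 2) (μ.map e) := by
      rw [hlaw]; exact (memLp_id_gaussianReal 2).integrable_sq
    constructor
    · exact h1.comp_measurable he
    · rw [← integral_map (f := fun x : ℝ => x ^ 2) he.aemeasurable (by fun_prop), hlaw]
      have := variance_fun_id_gaussianReal (μ := 0) (v := v)
      rwa [variance_of_integral_eq_zero (by fun_prop) (by simp)] at this
  obtain ⟨i1, e1⟩ := hsq (by fun_prop) hlaw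
  obtain ⟨i2, e2⟩ := hsq (by fun_prop) hlaw'
  have hint : Integrable (fun ω => l (Z ω, X ω, Y ω)) μ :=
    ((integrable_const _).sub (i2.div_const _)).add (i1.div_const _)
  have : IsProbabilityMeasure (μ.map Z) := Measure.isProbabilityMeasure_map hZ.aemeasurable
  have : IsProbabilityMeasure (μ.map fun ω => (Z ω, X ω, Y ω)) :=
    Measure.isProbabilityMeasure_map hT.aemeasurable
  rw [condMutualInfo, klDiv_withDensity_exp hlm ?_
    ((integrable_map_measure hlm.aestronglyMeasurable hT.aemeasurable).2 hint),
    integral_map hT.aemeasurable hlm.aestronglyMeasurable]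
  -- The residuals have second moments s and r, so the quadratic terms contribute -1/2 and 1/2 and
  -- cancel.
  · have : ∫ ω, l (Z ω, X ω, Y ω) ∂μ = 1 / 2 * Real.log (r / s) := by
      simp only [hl]
      rw [integral_add (f := fun ω => 1 / 2 * Real.log (r / s)
          - (Y ω - M' (Z ω, X ω)) ^ 2 / (2 * s))
          ((integrable_const _).sub (i2.div_const _)) (i1.div_const _),
        integral_sub (integrable_const _) (i2.div_const _), integral_div, integral_div, e1, e2]
      simp only [integral_const, probReal_univ, one_smul]
      field_simp
      ring
    rw [this, ← ENNReal.ofReal_div_of_pos (Real.log_pos (by norm_num)), Real.logb, mul_div_assoc]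
  -- Translating by the regressions turns both inner integrals into Lebesgue integrals over y,
  -- compared pointwise.
  · refine Measure.ext_of_lintegral _ fun f hf => ?_
    have hpf : Measurable fun p : (γ × α) × ℝ => f (p.1.1, p.1.2, p.2) := by fun_prop
    have hlf : Measurable fun p => ENNReal.ofReal (Real.exp (l p)) * f p := by fun_prop
    rw [lintegral_map hf hT, lintegral_withDensity_eq_lintegral_mul _ (by fun_prop) hf]
    simp only [Pi.mul_apply]
    rw [lintegral_compProd_condDistrib hZ hX hY hM hind hlaw hlf,
      lintegral_regression (Z := fun ω => (Z ω, X ω)) (hZ.prodMk hX) hY hM' hind' hlaw' hpf]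
    refine lintegral_congr fun q => ?_
    rw [lintegral_gaussianReal_add hs _ (f := fun y => f (q.1, q.2, y)) (by fun_prop),
      lintegral_gaussianReal_add hr _ (f := fun y =>
        ENNReal.ofReal (Real.exp (l (q.1, q.2, y))) * f (q.1, q.2, y)) (by fun_prop)]
    refine lintegral_congr fun y => ?_
    rw [gaussianPDF_mul_exp hr hs (y - M' q) (y - M q.1), mul_assoc]

end Information

/-! ### Gaussian subspaces of L² and linear regression -/

section GaussianHilbert

variable {Ω : Type*} [MeasurableSpace Ω] {μ : Measure Ω}

/-- A square-integrable random variable with a centred Gaussian law. -/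
def IsCentredGaussian (f : Lp ℝ 2 μ) : Prop := μ.map f = gaussianReal 0 (‖f‖₊ ^ 2)

lemma aemeasurable_coe (f : Lp ℝ 2 μ) : AEMeasurable f μ := (Lp.aestronglyMeasurable f).aemeasurable

lemma integral_sq_eq_norm_sq (f : Lp ℝ 2 μ) : ∫ ω, f ω ^ 2 ∂μ = ‖f‖ ^ 2 := by
  rw [← real_inner_self_eq_norm_sq, L2.inner_def]
  simp [sq]

lemma inner_toLp {f g : Ω → ℝ} (hf : MemLp f 2 μ) (hg : MemLp g 2 μ) :
    inner ℝ (hf.toLp f) (hg.toLp g) = ∫ ω, f ω * g ω ∂μ := by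
  rw [L2.inner_def]
  refine integral_congr_ae ?_
  filter_upwards [hf.coeFn_toLp, hg.coeFn_toLp] with ω h1 h2
  simp [h1, h2, mul_comm]

lemma isCentredGaussian_of_hasGaussianLaw {f : Lp ℝ 2 μ} (hf : HasGaussianLaw f μ)
    (h0 : ∫ ω, f ω ∂μ = 0) : IsCentredGaussian f := by
  rw [IsCentredGaussian, hf.map_eq_gaussianReal, h0,
    variance_of_integral_eq_zero (aemeasurable_coe f) h0, integral_sq_eq_norm_sq]
  congr 1
  ext
  simp

lemma IsCentredGaussian.integral_eq_zero {f : Lp ℝ 2 μ} (hf : IsCentredGaussian f) :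
    ∫ ω, f ω ∂μ = 0 := by
  rw [← integral_map (f := fun x : ℝ => x) (aemeasurable_coe f) (by fun_prop), hf]
  exact integral_id_gaussianReal

lemma toLp_sum_smul {ι : Type*} {X : ι → Ω → ℝ} (hX : ∀ i, MemLp (X i) 2 μ) (s : Finset ι)
    (c : ι → ℝ) :
    (⇑(∑ i ∈ s, c i • (hX i).toLp (X i)) : Ω → ℝ) =ᵐ[μ] fun ω => ∑ i ∈ s, c i * X i ω := by
  have h1 : MemLp (fun ω => ∑ i ∈ s, c i * X i ω) 2 μ :=
    memLp_finsetSum _ fun i _ => (hX i).const_mul (c i)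
  have h2 : h1.toLp _ = ∑ i ∈ s, c i • (hX i).toLp (X i) := by
    classical
    induction s using Finset.induction_on with
    | empty =>
      simp only [Finset.sum_empty]
      exact MemLp.toLp_zero _
    | insert a s ha ih =>
      simp only [Finset.sum_insert ha]
      rw [← ih (memLp_finsetSum _ fun i _ => (hX i).const_mul (c i)),
        ← MemLp.toLp_const_smul, ← MemLp.toLp_add]
      rfl
  rw [← h2]
  exact h1.coeFn_toLp

/-- Cramér-Wold: a linear functional of finitely many coordinates is again an element of E, hence
Gaussian. Joint Gaussianity thus reduces to membership in one subspace. -/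
lemma isGaussianProcess_of_mem {T : Type*} {X : T → Ω → ℝ} (hX : ∀ t, MemLp (X t) 2 μ)
    {E : Submodule ℝ (Lp ℝ 2 μ)} (hE : ∀ f ∈ E, IsCentredGaussian f)
    (hmem : ∀ t, (hX t).toLp (X t) ∈ E) : IsGaussianProcess X μ := by
  classical
  refine ⟨fun I => ⟨isGaussian_of_map_eq_gaussianReal fun L => ?_⟩⟩
  have hm : AEMeasurable (fun ω => I.restrict fun t => X t ω) μ :=
    aemeasurable_pi_lambda _ fun t => (hX t).aestronglyMeasurable.aemeasurable
  set f : Lp ℝ 2 μ := ∑ i : I, L (Pi.single i 1) • (hX i).toLp (X i) with hf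
  have hfE : f ∈ E := Submodule.sum_mem _ fun i _ => Submodule.smul_mem _ _ (hmem i)
  refine ⟨0, ‖f‖₊ ^ 2, ?_⟩
  rw [← hE f hfE, AEMeasurable.map_map_of_aemeasurable (by fun_prop) hm]
  refine Measure.map_congr ?_
  filter_upwards [toLp_sum_smul (fun i : I => hX i) Finset.univ
    fun i => L (Pi.single i 1)] with ω hω
  rw [hf, hω]
  simp only [Function.comp_apply]
  refine (LinearMap.pi_apply_eq_sum_univ L.toLinearMap (I.restrict fun t => X t ω)).trans ?_
  refine Finset.sum_congr rfl fun i _ => ?_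
  have : (fun j => if i = j then (1 : ℝ) else 0) = Pi.single i 1 := by
    ext j
    simp [Pi.single_apply, eq_comm]
  rw [this, smul_eq_mul, mul_comm]
  rfl

variable [IsProbabilityMeasure μ]

/-- Characteristic functions make both sides continuous in f for the L² norm, so that being centred
Gaussian is a closed condition. -/
lemma isCentredGaussian_iff {f : Lp ℝ 2 μ} :
    IsCentredGaussian f ↔ ∀ t : ℝ, ∫ ω, Complex.exp (t * f ω * Complex.I) ∂μ
      = Complex.exp (-((‖f‖ : ℂ) ^ 2 * t ^ 2 / 2)) := by
  have h1 : ∀ t : ℝ, charFun (μ.map f) t = ∫ ω, Complex.exp (t * f ω * Complex.I) ∂μ := by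
    intro t
    rw [charFun_apply_real, integral_map (aemeasurable_coe f) (by fun_prop)]
  have h2 : ∀ t : ℝ, charFun (gaussianReal 0 (‖f‖₊ ^ 2)) t
      = Complex.exp (-((‖f‖ : ℂ) ^ 2 * t ^ 2 / 2)) := by
    intro t
    rw [charFun_gaussianReal]
    congr 1
    simp
  constructor
  · intro h t
    rw [← h1, h, h2]
  · intro h
    have : IsProbabilityMeasure (μ.map f) := Measure.isProbabilityMeasure_map (aemeasurable_coe f)
    refine Measure.ext_of_charFun (funext fun t => ?_)
    rw [h1, h, h2]

lemma norm_exp_sub_exp_le (a b : ℝ) :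
    ‖Complex.exp (a * Complex.I) - Complex.exp (b * Complex.I)‖ ≤ |a - b| := by
  have h : Complex.exp (a * Complex.I) - Complex.exp (b * Complex.I)
      = Complex.exp (b * Complex.I) * (Complex.exp (Complex.I * (a - b : ℝ)) - 1) := by
    rw [mul_sub, ← Complex.exp_add, mul_one]
    congr 2
    push_cast
    ring
  rw [h, norm_mul, Complex.norm_exp_ofReal_mul_I, one_mul]
  exact Real.norm_exp_I_mul_ofReal_sub_one_le

lemma integral_abs_le_norm (f : Lp ℝ 2 μ) : ∫ ω, |f ω| ∂μ ≤ ‖f‖ := by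
  have h := eLpNorm_le_eLpNorm_of_exponent_le (p := 1) (q := 2) (by norm_num)
    (Lp.aestronglyMeasurable f)
  have h2 := ENNReal.toReal_mono (Lp.eLpNorm_ne_top f) h
  rw [Lp.norm_def]
  refine le_trans (le_of_eq ?_) h2
  rw [eLpNorm_one_eq_lintegral_enorm, ← integral_norm_eq_lintegral_enorm
    (Lp.aestronglyMeasurable f)]
  rfl

/-- The function x ↦ e^{itx} is |t|-Lipschitz, and the L¹ norm is at most the L² norm. -/
lemma continuous_integral_exp (t : ℝ) :
    Continuous fun f : Lp ℝ 2 μ => ∫ ω, Complex.exp (t * f ω * Complex.I) ∂μ := by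
  have hint : ∀ f : Lp ℝ 2 μ, Integrable (fun ω => Complex.exp (t * f ω * Complex.I)) μ := by
    intro f
    refine Integrable.of_bound ((Complex.continuous_exp.comp_aestronglyMeasurable
      (((Complex.continuous_ofReal.comp_aestronglyMeasurable
        (Lp.aestronglyMeasurable f)).const_mul _).mul_const _))) 1 (ae_of_all _ fun ω => ?_)
    rw [← Complex.ofReal_mul, Complex.norm_exp_ofReal_mul_I]
  refine LipschitzWith.continuous (K := ‖t‖₊) (LipschitzWith.of_dist_le_mul fun f g => ?_)
  rw [dist_eq_norm, dist_eq_norm, ← integral_sub (hint f) (hint g)]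
  refine (norm_integral_le_integral_norm _).trans ?_
  refine le_trans ?_ (mul_le_mul_of_nonneg_left (integral_abs_le_norm (f - g)) (norm_nonneg t))
  rw [← integral_const_mul]
  refine integral_mono_ae ((hint f).sub (hint g)).norm ?_ ?_
  · exact (((Lp.memLp (f - g)).integrable (by norm_num)).abs).const_mul _
  · filter_upwards [Lp.coeFn_sub f g] with ω hω
    simp only [hω, Pi.sub_apply]
    have := norm_exp_sub_exp_le (t * f ω) (t * g ω)
    rw [← mul_sub, abs_mul] at this
    simpa using this

lemma isClosed_isCentredGaussian : IsClosed {f : Lp ℝ 2 μ | IsCentredGaussian f} := by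
  simp only [isCentredGaussian_iff, Set.ofPred_forall]
  refine isClosed_iInter fun t => isClosed_eq (continuous_integral_exp t) ?_
  fun_prop

lemma isCentredGaussian_topologicalClosure {E : Submodule ℝ (Lp ℝ 2 μ)}
    (hE : ∀ f ∈ E, IsCentredGaussian f) : ∀ f ∈ E.topologicalClosure, IsCentredGaussian f := by
  intro f hf
  exact closure_minimal (fun g hg => hE g hg) isClosed_isCentredGaussian hf

lemma isCentredGaussian_of_mem_span {T : Type*} {X : T → Ω → ℝ} (hG : IsGaussianProcess X μ)
    (hX : ∀ t, MemLp (X t) 2 μ) (h0 : ∀ t, ∫ ω, X t ω ∂μ = 0) :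
    ∀ f ∈ Submodule.span ℝ (Set.range fun t => (hX t).toLp (X t)), IsCentredGaussian f := by
  intro f hf
  obtain ⟨c, rfl⟩ := Finsupp.mem_span_range_iff_exists_finsupp.1 hf
  have h := toLp_sum_smul hX c.support c
  refine isCentredGaussian_of_hasGaussianLaw ?_ ?_
  · exact HasGaussianLaw.congr (hG.smul c).hasGaussianLaw_fun_sum h.symm
  · rw [Finsupp.sum, integral_congr_ae h,
      integral_finsetSum _ fun i _ => ((hX i).integrable (by norm_num)).const_mul _]
    simp [integral_const_mul, h0]

lemma isCentredGaussian_add {f g : Lp ℝ 2 μ} (hf : IsCentredGaussian f)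
    (hg : IsCentredGaussian g) (hfg : IndepFun f g μ) : IsCentredGaussian (f + g) := by
  have hae := Lp.coeFn_add f g
  have hf' : HasGaussianLaw f μ := ⟨by rw [hf]; infer_instance⟩
  have hg' : HasGaussianLaw g μ := ⟨by rw [hg]; infer_instance⟩
  refine isCentredGaussian_of_hasGaussianLaw ?_ ?_
  · exact HasGaussianLaw.congr (IndepFun.hasGaussianLaw hf' hg' hfg).add hae.symm
  · rw [integral_congr_ae hae]
    simp only [Pi.add_apply]
    rw [integral_add ((Lp.memLp f).integrable (by norm_num))
      ((Lp.memLp g).integrable (by norm_num)), hf.integral_eq_zero, hg.integral_eq_zero, add_zero]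

/-- Linear regression in a Gaussian space: the residual is a centred Gaussian variable independent
of the regressors, whose variance is the squared distance to their span. -/
theorem exists_regression {ι : Type*} [Finite ι] {X : ι → Ω → ℝ} {Y : Ω → ℝ}
    (hX : ∀ i, MemLp (X i) 2 μ) (hY : MemLp Y 2 μ) {E : Submodule ℝ (Lp ℝ 2 μ)}
    (hE : ∀ f ∈ E, IsCentredGaussian f) (hXE : ∀ i, (hX i).toLp (X i) ∈ E)
    (hYE : hY.toLp Y ∈ E) :
    ∃ M : (ι → ℝ) → ℝ, Measurable M ∧
      IndepFun (fun ω i => X i ω) (fun ω => Y ω - M fun i => X i ω) μ ∧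
      μ.map (fun ω => Y ω - M fun i => X i ω) = gaussianReal 0 (Real.toNNReal
        (Metric.infDist (hY.toLp Y) (Submodule.span ℝ (Set.range fun i => (hX i).toLp (X i)))
          ^ 2)) := by
  have := Fintype.ofFinite ι
  set K := Submodule.span ℝ (Set.range fun i => (hX i).toLp (X i)) with hK
  have : FiniteDimensional ℝ K := FiniteDimensional.span_of_finite ℝ (Set.finite_range _)
  -- The regression is the orthogonal projection v, whose coefficients c define M.
  obtain ⟨v, hv, hmin⟩ := K.exists_norm_eq_iInf_of_complete_subspace
    K.complete_of_finiteDimensional (hY.toLp Y)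
  have horth := (K.norm_eq_iInf_iff_real_inner_eq_zero hv).1 hmin
  obtain ⟨c, hc⟩ := (Submodule.mem_span_range_iff_exists_fun ℝ).1 hv
  have hdist : Metric.infDist (hY.toLp Y) K = ‖hY.toLp Y - v‖ := by
    rw [hmin, Metric.infDist_eq_iInf]
    simp only [dist_eq_norm]
  set ε : Ω → ℝ := fun ω => Y ω - ∑ i, c i * X i ω with hε
  have hεL : MemLp ε 2 μ := hY.sub (memLp_finsetSum _ fun i _ => (hX i).const_mul _)
  have hεv : hεL.toLp ε = hY.toLp Y - v := by
    refine Lp.ext ?_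
    filter_upwards [hεL.coeFn_toLp, hY.coeFn_toLp, Lp.coeFn_sub (hY.toLp Y) v,
      toLp_sum_smul hX Finset.univ c] with ω h1 h2 h3 h4
    rw [h1, h3, Pi.sub_apply, h2, ← hc, h4]
  have hKE : K ≤ E := Submodule.span_le.2 (by rintro _ ⟨i, rfl⟩; exact hXE i)
  have hεE : hεL.toLp ε ∈ E := by rw [hεv]; exact E.sub_mem hYE (hKE hv)
  have hmean : ∀ {f : Ω → ℝ} (hf : MemLp f 2 μ), hf.toLp f ∈ E → ∫ ω, f ω ∂μ = 0 := by
    intro f hf h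
    rw [← (hE _ h).integral_eq_zero]
    exact integral_congr_ae hf.coeFn_toLp.symm
  refine ⟨fun x => ∑ i, c i * x i, by fun_prop, ?_, ?_⟩
  -- Regressors and residual are jointly Gaussian, so orthogonality upgrades to independence.
  · have hG : IsGaussianProcess (Sum.elim X fun _ : Unit => ε) μ := by
      refine isGaussianProcess_of_mem (E := E) ?_ hE ?_
      · rintro (i | _)
        · exact hX i
        · exact hεL
      · rintro (i | _)
        · exact hXE i
        · exact hεE
    have h := hG.indepFun_of_covariance_eq_zero
      (fun i => (hX i).aestronglyMeasurable.aemeasurable)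
      (fun _ => hεL.aestronglyMeasurable.aemeasurable) ?_
    · exact h.comp (φ := id) (ψ := fun x : Unit → ℝ => x ()) measurable_id (by fun_prop)
    · intro i _
      rw [covariance_eq_sub (hX i) hεL, hmean _ (hXE i), zero_mul, sub_zero]
      have := horth _ (Submodule.subset_span (Set.mem_range_self i))
      rw [← hεv, inner_toLp] at this
      rw [← this]
      refine integral_congr_ae (ae_of_all _ fun ω => ?_)
      simp [mul_comm]
  · have h1 : μ.map ε = μ.map (hεL.toLp ε) := Measure.map_congr hεL.coeFn_toLp.symm
    change μ.map ε = _
    rw [h1, hE _ hεE, hdist, hεv]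
    congr 1
    ext
    simp

/-- An element splits into a combination of the X and one of the Y, which are independent Gaussians;
joint Gaussianity of the two processes is not assumed. -/
lemma isCentredGaussian_of_mem_sup {S T : Type*} {X : S → Ω → ℝ} {Y : T → Ω → ℝ}
    (hGX : IsGaussianProcess X μ) (hGY : IsGaussianProcess Y μ)
    (hX : ∀ t, MemLp (X t) 2 μ) (hY : ∀ t, MemLp (Y t) 2 μ)
    (hX0 : ∀ t, ∫ ω, X t ω ∂μ = 0) (hY0 : ∀ t, ∫ ω, Y t ω ∂μ = 0)
    (hind : IndepFun (fun ω t => X t ω) (fun ω t => Y t ω) μ) :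
    ∀ f ∈ Submodule.span ℝ (Set.range fun t => (hX t).toLp (X t)) ⊔
      Submodule.span ℝ (Set.range fun t => (hY t).toLp (Y t)), IsCentredGaussian f := by
  intro f hf
  obtain ⟨g, hg, h, hh, rfl⟩ := Submodule.mem_sup.1 hf
  refine isCentredGaussian_add (isCentredGaussian_of_mem_span hGX hX hX0 g hg)
    (isCentredGaussian_of_mem_span hGY hY hY0 h hh) ?_
  obtain ⟨c, rfl⟩ := Finsupp.mem_span_range_iff_exists_finsupp.1 hg
  obtain ⟨d, rfl⟩ := Finsupp.mem_span_range_iff_exists_finsupp.1 hh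
  refine IndepFun.congr ?_ (toLp_sum_smul hX c.support c).symm (toLp_sum_smul hY d.support d).symm
  exact hind.comp (φ := fun x => ∑ i ∈ c.support, c i * x i)
    (ψ := fun x => ∑ i ∈ d.support, d i * x i) (by fun_prop) (by fun_prop)

end GaussianHilbert

/-! ### Szegő's theorem on the unit circle -/

section Szego

open Polynomial in
/-- The value `p(e^{iθ})`. -/
noncomputable def circleEval (p : ℝ[X]) (θ : ℝ) : ℂ := aeval (Complex.exp (θ * Complex.I)) p

open Polynomial in
lemma continuous_circleEval (p : ℝ[X]) : Continuous (circleEval p) := by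
  unfold circleEval
  fun_prop

/-- The functional `g ↦ κ ∫ e^g S · e^{-κ ∫ g}`, invariant under adding constants to `g` when
`κ` is the inverse of the total mass. -/
noncomputable def weightedExp (ν : Measure ℝ) (κ : ℝ) (S g : ℝ → ℝ) : ℝ :=
  κ * (∫ θ, Real.exp (g θ) * S θ ∂ν) * Real.exp (-(κ * ∫ θ, g θ ∂ν))

variable {ν : Measure ℝ} {κ : ℝ} {S : ℝ → ℝ}

/-- Bounded almost everywhere convergence of exponents suffices, so an exponent can be replaced by a
continuous one and then by a trigonometric polynomial. -/
lemma tendsto_weightedExp [IsFiniteMeasure ν] (hS : Integrable S ν) {c : ℕ → ℝ → ℝ} {g : ℝ → ℝ}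
    {M : ℝ} (hm : ∀ n, AEStronglyMeasurable (c n) ν) (hb : ∀ n, ∀ᵐ θ ∂ν, |c n θ| ≤ M)
    (hl : ∀ᵐ θ ∂ν, Tendsto (fun n => c n θ) atTop (𝓝 (g θ))) :
    Tendsto (fun n => weightedExp ν κ S (c n)) atTop (𝓝 (weightedExp ν κ S g)) := by
  have h1 : Tendsto (fun n => ∫ θ, c n θ ∂ν) atTop (𝓝 (∫ θ, g θ ∂ν)) :=
    tendsto_integral_of_dominated_convergence (fun _ => M) hm (integrable_const _) hb hl
  have h2 : Tendsto (fun n => ∫ θ, Real.exp (c n θ) * S θ ∂ν) atTop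
      (𝓝 (∫ θ, Real.exp (g θ) * S θ ∂ν)) := by
    refine tendsto_integral_of_dominated_convergence (fun θ => Real.exp M * |S θ|)
      (fun n => (Real.continuous_exp.comp_aestronglyMeasurable (hm n)).mul hS.1)
      (hS.abs.const_mul _) (fun n => ?_) ?_
    · filter_upwards [hb n] with θ hθ
      rw [norm_mul, Real.norm_eq_abs, Real.norm_eq_abs, Real.abs_exp]
      gcongr
      exact (abs_le.1 hθ).2
    · filter_upwards [hl] with θ hθ
      exact ((Real.continuous_exp.tendsto _).comp hθ).mul_const _
  exact (h2.const_mul κ).mul ((Real.continuous_exp.tendsto _).comp (h1.const_mul κ).neg)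

/-- Truncation to `[-M, M]`. -/
noncomputable def clamp (M x : ℝ) : ℝ := max (-M) (min M x)

lemma abs_clamp_le {M : ℝ} (hM : 0 ≤ M) (x : ℝ) : |clamp M x| ≤ M := by
  rw [abs_le, clamp]
  exact ⟨le_max_left _ _, max_le (by linarith) (min_le_left _ _)⟩

lemma abs_clamp_le_abs {M : ℝ} (hM : 0 ≤ M) (x : ℝ) : |clamp M x| ≤ |x| := by
  rw [clamp, abs_le]
  have := neg_abs_le x
  have := le_abs_self x
  have := abs_nonneg x
  refine ⟨le_max_of_le_right (le_min (by linarith) (by linarith)),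
    max_le (by linarith) ((min_le_right _ _).trans (by linarith))⟩

lemma clamp_le_max {M : ℝ} (hM : 0 ≤ M) (x : ℝ) : clamp M x ≤ max x 0 := by
  rw [clamp]
  exact max_le (le_max_of_le_right (by linarith)) ((min_le_right _ _).trans (le_max_left _ _))

lemma continuous_clamp (M : ℝ) : Continuous (clamp M) := by
  unfold clamp
  fun_prop

lemma clamp_of_abs_le {M x : ℝ} (h : |x| ≤ M) : clamp M x = x := by
  rw [abs_le] at h
  rw [clamp, min_eq_right h.2, max_eq_right h.1]

lemma tendsto_weightedExp_clamp [IsFiniteMeasure ν] (hS : Integrable S ν)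
    (hS0 : ∀ᵐ θ ∂ν, 0 < S θ) (hlog : Integrable (fun θ => Real.log (S θ)) ν) (L : ℝ) :
    Tendsto (fun M : ℕ => weightedExp ν κ S (fun θ => clamp M (L - Real.log (S θ)))) atTop
      (𝓝 (weightedExp ν κ S (fun θ => L - Real.log (S θ)))) := by
  have hi : Integrable (fun θ => L - Real.log (S θ)) ν := (integrable_const _).sub hlog
  have hm : ∀ M : ℕ, AEStronglyMeasurable (fun θ => clamp M (L - Real.log (S θ))) ν := fun M =>
    (continuous_clamp M).comp_aestronglyMeasurable hi.1
  have hl : ∀ θ, Tendsto (fun M : ℕ => clamp M (L - Real.log (S θ))) atTop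
      (𝓝 (L - Real.log (S θ))) := by
    intro θ
    refine tendsto_const_nhds.congr' ?_
    filter_upwards [(tendsto_natCast_atTop_atTop (R := ℝ)).eventually_ge_atTop
      |L - Real.log (S θ)|] with M hM
    rw [clamp_of_abs_le hM]
  have h1 := tendsto_integral_of_dominated_convergence (fun θ => |L - Real.log (S θ)|) hm hi.abs
    (fun M => ae_of_all _ fun θ => abs_clamp_le_abs (Nat.cast_nonneg M) _) (ae_of_all _ hl)
  have h2 : Tendsto (fun M : ℕ => ∫ θ, Real.exp (clamp M (L - Real.log (S θ))) * S θ ∂ν) atTop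
      (𝓝 (∫ θ, Real.exp (L - Real.log (S θ)) * S θ ∂ν)) := by
    refine tendsto_integral_of_dominated_convergence (fun θ => Real.exp L + S θ)
      (fun n => (Real.continuous_exp.comp_aestronglyMeasurable (hm n)).mul hS.1)
      ((integrable_const _).add hS) (fun M => ?_)
      (ae_of_all _ fun θ => ((Real.continuous_exp.tendsto _).comp (hl θ)).mul_const _)
    filter_upwards [hS0] with θ hθ
    rw [Real.norm_of_nonneg (by positivity)]
    -- The truncated exponent is at most max(L - log S, 0), so its exponential times S is at most
    -- e^L + S, uniformly in M.
    have h3 : Real.exp (clamp M (L - Real.log (S θ))) ≤ Real.exp L / S θ + 1 := by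
      refine (Real.exp_le_exp.2 (clamp_le_max (Nat.cast_nonneg M) _)).trans ?_
      rcases max_choice (L - Real.log (S θ)) 0 with h | h <;> rw [h]
      · rw [Real.exp_sub, Real.exp_log hθ]
        linarith
      · rw [Real.exp_zero]
        have : 0 < Real.exp L / S θ := by positivity
        linarith
    calc _ ≤ (Real.exp L / S θ + 1) * S θ := by gcongr
      _ = _ := by field_simp
  exact (h2.const_mul κ).mul ((Real.continuous_exp.tendsto _).comp (h1.const_mul κ).neg)

/-- As κ is the inverse mass, the exponent L - log S has mean zero, and e^{L - log S} S is the
constant e^L. The value is the geometric mean to be approached. -/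
lemma weightedExp_log [IsFiniteMeasure ν] (hS0 : ∀ᵐ θ ∂ν, 0 < S θ)
    (hlog : Integrable (fun θ => Real.log (S θ)) ν) (hκ : κ * ν.real Set.univ = 1) :
    weightedExp ν κ S (fun θ => κ * (∫ θ, Real.log (S θ) ∂ν) - Real.log (S θ))
      = Real.exp (κ * ∫ θ, Real.log (S θ) ∂ν) := by
  set L := κ * ∫ θ, Real.log (S θ) ∂ν with hL
  have h1 : ∫ θ, Real.exp (L - Real.log (S θ)) * S θ ∂ν = ν.real Set.univ * Real.exp L := by
    rw [← smul_eq_mul, ← integral_const]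
    refine integral_congr_ae ?_
    filter_upwards [hS0] with θ hθ
    rw [Real.exp_sub, Real.exp_log hθ]
    field_simp
  have h2 : κ * ∫ θ, (L - Real.log (S θ)) ∂ν = 0 := by
    rw [integral_sub (integrable_const _) hlog, integral_const, smul_eq_mul, mul_sub, ← mul_assoc,
      hκ, one_mul, ← hL, sub_self]
  rw [weightedExp, h1, h2, ← mul_assoc, hκ]
  simp

/-- A bounded function is a bounded almost everywhere limit of continuous functions. -/
lemma exists_continuous_tendsto_ae [IsFiniteMeasure ν] {g : ℝ → ℝ} {M : ℝ} (hM : 0 ≤ M)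
    (hg : AEStronglyMeasurable g ν) (hb : ∀ θ, |g θ| ≤ M) :
    ∃ c : ℕ → ℝ → ℝ, (∀ n, Continuous (c n)) ∧ (∀ n θ, |c n θ| ≤ M) ∧
      ∀ᵐ θ ∂ν, Tendsto (fun n => c n θ) atTop (𝓝 (g θ)) := by
  have hgi : MemLp g 1 ν := memLp_one_iff_integrable.2
    (Integrable.of_bound hg M (ae_of_all _ hb))
  have h1 : ∀ n : ℕ, ∃ f : BoundedContinuousFunction ℝ ℝ,
      eLpNorm (g - ⇑f) 1 ν ≤ ((n : ℝ≥0∞) + 1)⁻¹ ∧ MemLp f 1 ν := fun n =>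
    hgi.exists_boundedContinuous_eLpNorm_sub_le ENNReal.one_ne_top (by simp)
  choose f hf hfm using h1
  have h2 : TendstoInMeasure ν (fun n => ⇑(f n)) atTop g := by
    refine tendstoInMeasure_of_tendsto_eLpNorm one_ne_zero (fun n => (hfm n).1) hg ?_
    refine tendsto_of_tendsto_of_tendsto_of_le_of_le (h := fun n : ℕ => ((n : ℝ≥0∞) + 1)⁻¹)
      tendsto_const_nhds ?_ (fun _ => zero_le)
      (fun n => by rw [eLpNorm_sub_comm]; exact hf n)
    have := (ENNReal.tendsto_inv_nat_nhds_zero.comp (tendsto_add_atTop_nat 1))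
    simpa [Function.comp_def] using this
  obtain ⟨φ, -, hφ⟩ := h2.exists_seq_tendsto_ae
  refine ⟨fun n θ => clamp M (f (φ n) θ), fun n => (continuous_clamp M).comp (f (φ n)).continuous,
    fun n θ => abs_clamp_le hM _, ?_⟩
  filter_upwards [hφ] with θ hθ
  rw [← clamp_of_abs_le (hb θ)]
  exact ((continuous_clamp M).tendsto _).comp hθ

open Polynomial in
/-- A continuous function on `[0, π]` is a uniform limit of polynomials in `cos θ`. -/
lemma exists_polynomial_cos_near {c : ℝ → ℝ} (hc : Continuous c) {ε : ℝ} (hε : 0 < ε) :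
    ∃ q : ℝ[X], ∀ θ ∈ Set.Icc 0 Real.pi, |q.eval (Real.cos θ) - c θ| < ε := by
  obtain ⟨q, hq⟩ := exists_polynomial_near_of_continuousOn (-1) 1 (fun x => c (Real.arccos x))
    (hc.comp Real.continuous_arccos).continuousOn ε hε
  refine ⟨q, fun θ hθ => ?_⟩
  have := hq (Real.cos θ) ⟨Real.neg_one_le_cos θ, Real.cos_le_one θ⟩
  rwa [Real.arccos_cos hθ.1 hθ.2] at this

open Polynomial in
-- On monomials this is 2 cos θ cos mθ = cos (m+1)θ + cos (m-1)θ.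
lemma exists_cos_mul_circleEval_re (P : ℝ[X]) :
    ∃ P' : ℝ[X], ∀ θ, (circleEval P' θ).re = Real.cos θ * (circleEval P θ).re := by
  have hX : ∀ (a : ℝ) (n : ℕ) (θ : ℝ),
      (circleEval (monomial n a) θ).re = a * Real.cos (n * θ) := by
    intro a n θ
    rw [circleEval, aeval_monomial, ← Complex.exp_nat_mul, ← mul_assoc]
    have := Complex.exp_ofReal_mul_I_re (n * θ)
    push_cast at this
    simp [this]
  induction P using Polynomial.induction_on' with
  | add p q hp hq =>
    obtain ⟨p', hp⟩ := hp
    obtain ⟨q', hq⟩ := hq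
    refine ⟨p' + q', fun θ => ?_⟩
    have h1 := hp θ
    have h2 := hq θ
    simp only [circleEval, map_add, Complex.add_re] at h1 h2 ⊢
    rw [h1, h2]
    ring
  | monomial n a =>
    rcases n with _ | n
    · exact ⟨monomial 1 a, fun θ => by rw [hX, hX]; simp [mul_comm]⟩
    · refine ⟨monomial (n + 2) (a / 2) + monomial n (a / 2), fun θ => ?_⟩
      have h1 := hX (a / 2) (n + 2) θ
      have h2 := hX (a / 2) n θ
      rw [hX]
      simp only [circleEval, map_add, Complex.add_re] at h1 h2 ⊢
      rw [h1, h2]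
      have e1 : ((n + 2 : ℕ) : ℝ) * θ = ((n + 1 : ℕ) : ℝ) * θ + θ := by push_cast; ring
      have e2 : (n : ℝ) * θ = ((n + 1 : ℕ) : ℝ) * θ - θ := by push_cast; ring
      rw [e1, e2, Real.cos_add, Real.cos_sub]
      ring

open Polynomial in
/-- A polynomial in `cos θ` is the real part of a polynomial in `e^{iθ}`. -/
lemma exists_circleEval_re_eq (q : ℝ[X]) :
    ∃ P : ℝ[X], ∀ θ, (circleEval P θ).re = q.eval (Real.cos θ) := by
  have hpow : ∀ n : ℕ, ∃ P : ℝ[X], ∀ θ, (circleEval P θ).re = Real.cos θ ^ n := by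
    intro n
    induction n with
    | zero => exact ⟨1, fun θ => by simp [circleEval]⟩
    | succ n ih =>
      obtain ⟨P, hP⟩ := ih
      obtain ⟨P', hP'⟩ := exists_cos_mul_circleEval_re P
      exact ⟨P', fun θ => by rw [hP', hP, pow_succ']⟩
  induction q using Polynomial.induction_on' with
  | add p q hp hq =>
    obtain ⟨p', hp⟩ := hp
    obtain ⟨q', hq⟩ := hq
    refine ⟨p' + q', fun θ => ?_⟩
    have h1 := hp θ
    have h2 := hq θ
    simp only [circleEval, map_add, Complex.add_re, eval_add] at h1 h2 ⊢
    rw [h1, h2]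
  | monomial n a =>
    obtain ⟨P, hP⟩ := hpow n
    refine ⟨C a * P, fun θ => ?_⟩
    have h1 := hP θ
    simp only [circleEval, map_mul, aeval_C] at h1 ⊢
    simp [h1]

open Polynomial in
lemma integral_circleEval_re (P : ℝ[X]) :
    ∫ θ in (0 : ℝ)..Real.pi, (circleEval P θ).re = Real.pi * P.coeff 0 := by
  have hi : ∀ p : ℝ[X], IntervalIntegrable (fun θ => (circleEval p θ).re) volume 0 Real.pi :=
    fun p => (Complex.continuous_re.comp (continuous_circleEval p)).intervalIntegrable _ _
  induction P using Polynomial.induction_on' with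
  | add p q hp hq =>
    rw [coeff_add, mul_add, ← hp, ← hq, ← intervalIntegral.integral_add (hi p) (hi q)]
    simp [circleEval]
  | monomial n a =>
    have hX : ∀ θ, (circleEval (monomial n a) θ).re = a * Real.cos (n * θ) := by
      intro θ
      rw [circleEval, aeval_monomial, ← Complex.exp_nat_mul, ← mul_assoc]
      have := Complex.exp_ofReal_mul_I_re (n * θ)
      push_cast at this
      simp [this]
    simp_rw [hX]
    rcases n with _ | n
    · simp [mul_comm]
    · rw [intervalIntegral.integral_const_mul, intervalIntegral.integral_comp_mul_left
        (fun x => Real.cos x) (by positivity), integral_cos, Real.sin_nat_mul_pi]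
      simp [coeff_monomial]

open Polynomial in
/-- The partial sums of the exponential series of `P / 2`. -/
noncomputable def expPartial (P : ℝ[X]) (N : ℕ) : ℝ[X] :=
  ∑ j ∈ Finset.range N, C ((j.factorial : ℝ)⁻¹) * (C (1 / 2) * P) ^ j

open Polynomial in
-- Powers P^j with j ≥ 1 vanish at 0. Constant coefficient one is the constraint of the prediction
-- problem: x_t enters with weight one.
lemma coeff_zero_expPartial {P : ℝ[X]} (hP : P.coeff 0 = 0) (N : ℕ) :
    (expPartial P (N + 1)).coeff 0 = 1 := by
  rw [expPartial, finsetSum_coeff, Finset.sum_range_succ']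
  simp [coeff_zero_eq_eval_zero, eval_pow, coeff_zero_eq_eval_zero P ▸ hP]

open Polynomial in
lemma circleEval_expPartial (P : ℝ[X]) (N : ℕ) (θ : ℝ) :
    circleEval (expPartial P N) θ
      = ∑ j ∈ Finset.range N, (circleEval P θ / 2) ^ j / (j.factorial : ℂ) := by
  simp only [circleEval, expPartial, map_sum, map_mul, map_pow, aeval_C]
  refine Finset.sum_congr rfl fun j _ => ?_
  simp
  ring

open Polynomial in
-- The factor 1/2 in `expPartial` is there for |e^{P/2}|² = e^{Re P}.
lemma tendsto_norm_circleEval_expPartial (P : ℝ[X]) (θ : ℝ) :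
    Tendsto (fun N => ‖circleEval (expPartial P N) θ‖ ^ 2) atTop
      (𝓝 (Real.exp (circleEval P θ).re)) := by
  have h : Tendsto (fun N => circleEval (expPartial P N) θ) atTop
      (𝓝 (Complex.exp (circleEval P θ / 2))) := by
    simp_rw [circleEval_expPartial]
    rw [Complex.exp_eq_exp_ℂ]
    exact (NormedSpace.expSeries_div_hasSum_exp (circleEval P θ / 2)).tendsto_sum_nat
  have h2 := (h.norm).pow 2
  rw [Complex.norm_exp, ← Real.exp_nat_mul] at h2
  convert h2 using 2
  simp
  ring

open Polynomial in
lemma norm_circleEval_expPartial_le (P : ℝ[X]) (N : ℕ) (θ : ℝ) :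
    ‖circleEval (expPartial P N) θ‖ ^ 2 ≤ Real.exp ‖circleEval P θ‖ := by
  have h : ‖circleEval (expPartial P N) θ‖ ≤ Real.exp (‖circleEval P θ‖ / 2) := by
    rw [circleEval_expPartial]
    refine (norm_sum_le _ _).trans
      (le_trans (le_of_eq ?_) (Real.sum_le_exp_of_nonneg (by positivity) N))
    refine Finset.sum_congr rfl fun j _ => ?_
    simp
  calc _ ≤ Real.exp (‖circleEval P θ‖ / 2) ^ 2 := by gcongr
    _ = _ := by rw [← Real.exp_nat_mul]; congr 1; push_cast; ring

open Polynomial in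
/-- The hard half of Szegő's theorem, for weights on the half circle. -/
lemma exists_polynomial_integral_lt_half {S : ℝ → ℝ}
    (hS : Integrable S (volume.restrict (Set.Ioc 0 Real.pi)))
    (hS0 : ∀ᵐ θ ∂(volume.restrict (Set.Ioc 0 Real.pi)), 0 < S θ)
    (hlog : Integrable (fun θ => Real.log (S θ)) (volume.restrict (Set.Ioc 0 Real.pi)))
    {ε : ℝ} (hε : 0 < ε) :
    ∃ p : ℝ[X], p.coeff 0 = 1 ∧
      Real.pi⁻¹ * (∫ θ in Set.Ioc 0 Real.pi, ‖circleEval p θ‖ ^ 2 * S θ)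
        < Real.exp (Real.pi⁻¹ * ∫ θ in Set.Ioc 0 Real.pi, Real.log (S θ)) + ε := by
  set ν := volume.restrict (Set.Ioc 0 Real.pi) with hν
  set L := Real.pi⁻¹ * ∫ θ, Real.log (S θ) ∂ν with hL
  have hκ : Real.pi⁻¹ * ν.real Set.univ = 1 := by
    rw [hν, measureReal_restrict_apply_univ, Real.volume_real_Ioc_of_le Real.pi_pos.le, sub_zero,
      inv_mul_cancel₀ Real.pi_ne_zero]
  have hlim := tendsto_weightedExp_clamp (κ := Real.pi⁻¹) hS hS0 hlog L
  rw [weightedExp_log hS0 hlog hκ] at hlim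
  -- A strict inequality is kept through successive replacements of the exponent: truncated,
  -- continuous, polynomial in cos θ.
  obtain ⟨M, hM⟩ := (hlim.eventually_lt_const (lt_add_of_pos_right _ hε)).exists
  obtain ⟨c, hc, hcM, hcl⟩ := exists_continuous_tendsto_ae (Nat.cast_nonneg M)
    ((continuous_clamp M).comp_aestronglyMeasurable ((integrable_const L).sub hlog).1)
    (fun θ => abs_clamp_le (Nat.cast_nonneg M) _)
  obtain ⟨n, hn⟩ := ((tendsto_weightedExp (κ := Real.pi⁻¹) hS
    (fun n => (hc n).aestronglyMeasurable) (fun n => ae_of_all _ (hcM n))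
    hcl).eventually_lt_const hM).exists
  have hq : ∀ k : ℕ, ∃ q : ℝ[X], ∀ θ ∈ Set.Icc 0 Real.pi,
      |q.eval (Real.cos θ) - c n θ| < 1 / ((k : ℝ) + 1) := fun k =>
    exists_polynomial_cos_near (hc n) (by positivity)
  choose q hq using hq
  have hmem : ∀ᵐ θ ∂ν, θ ∈ Set.Icc 0 Real.pi :=
    (ae_restrict_mem measurableSet_Ioc).mono fun θ hθ => Set.Ioc_subset_Icc_self hθ
  have hql := tendsto_weightedExp (κ := Real.pi⁻¹) (ν := ν) hS
    (c := fun k θ => (q k).eval (Real.cos θ)) (g := c n) (M := M + 1)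
    (fun k => ((q k).continuous.comp Real.continuous_cos).aestronglyMeasurable) ?_ ?_
  rotate_left
  · intro k
    filter_upwards [hmem] with θ hθ
    have h1 := hq k θ hθ
    have h2 := hcM n θ
    have h3 : 1 / ((k : ℝ) + 1) ≤ 1 := by
      rw [div_le_one (by positivity)]
      linarith [Nat.cast_nonneg (α := ℝ) k]
    have h4 := abs_add_le ((q k).eval (Real.cos θ) - c n θ) (c n θ)
    rw [sub_add_cancel] at h4
    linarith
  · filter_upwards [hmem] with θ hθ
    rw [tendsto_iff_norm_sub_tendsto_zero]
    exact squeeze_zero (fun _ => norm_nonneg _) (fun k => (hq k θ hθ).le)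
      tendsto_one_div_add_atTop_nhds_zero_nat
  obtain ⟨k, hk⟩ := (hql.eventually_lt_const hn).exists
  obtain ⟨P, hP⟩ := exists_circleEval_re_eq (q k)
  -- Without its constant coefficient, Re P' has mean zero and the normalising factor of
  -- `weightedExp` disappears; adding constants does not change the functional.
  set P' := P - C (P.coeff 0) with hP'
  have hre : ∀ θ, (circleEval P' θ).re = (q k).eval (Real.cos θ) - P.coeff 0 := by
    intro θ
    rw [← hP θ]
    simp [circleEval, hP']
  have hJ : Real.pi⁻¹ * ∫ θ, Real.exp (circleEval P' θ).re * S θ ∂ν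
      = weightedExp ν Real.pi⁻¹ S (fun θ => (q k).eval (Real.cos θ)) := by
    have h1 : ∫ θ, (q k).eval (Real.cos θ) ∂ν = Real.pi * P.coeff 0 := by
      rw [← integral_circleEval_re, intervalIntegral.integral_of_le Real.pi_pos.le]
      simp_rw [hP]
      rfl
    have h2 : ∀ θ, Real.exp (circleEval P' θ).re * S θ
        = (Real.exp (P.coeff 0))⁻¹ * (Real.exp ((q k).eval (Real.cos θ)) * S θ) := by
      intro θ
      rw [hre, Real.exp_sub]
      ring
    simp_rw [weightedExp, h1, inv_mul_cancel_left₀ Real.pi_ne_zero, h2, integral_const_mul,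
      Real.exp_neg]
    ring
  have hcont : ∀ p : ℝ[X], Continuous fun θ => ‖circleEval p θ‖ := fun p =>
    (continuous_circleEval p).norm
  -- The function e^{P'/2} is replaced by a partial sum of its series, a genuine polynomial; N + 1
  -- keeps the term j = 0.
  have hexp : Tendsto (fun N => ∫ θ, ‖circleEval (expPartial P' (N + 1)) θ‖ ^ 2 * S θ ∂ν) atTop
      (𝓝 (∫ θ, Real.exp (circleEval P' θ).re * S θ ∂ν)) := by
    obtain ⟨B, hB⟩ := (isCompact_Icc (a := 0) (b := Real.pi)).exists_bound_of_continuousOn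
      (hcont P').continuousOn
    refine tendsto_integral_of_dominated_convergence (fun θ => Real.exp B * |S θ|)
      (fun N => ((hcont _).pow 2).aestronglyMeasurable.mul hS.1) (hS.abs.const_mul _)
      (fun N => ?_) ?_
    · filter_upwards [hmem] with θ hθ
      rw [norm_mul, Real.norm_of_nonneg (by positivity : (0 : ℝ) ≤ ‖_‖ ^ 2), Real.norm_eq_abs]
      gcongr
      refine (norm_circleEval_expPartial_le _ _ _).trans (Real.exp_le_exp.2 ?_)
      simpa using hB θ hθ
    · exact ae_of_all _ fun θ => ((tendsto_norm_circleEval_expPartial P' θ).comp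
        (tendsto_add_atTop_nat 1)).mul_const _
  rw [← hJ] at hk
  obtain ⟨N, hN⟩ := ((hexp.const_mul Real.pi⁻¹).eventually_lt_const hk).exists
  exact ⟨expPartial P' (N + 1), coeff_zero_expPartial (by simp [hP']) N, hN⟩

/-- Reduces the full circle to [0, π], where cos is injective and polynomials in cos θ approximate
every continuous function. -/
lemma integral_even {f : ℝ → ℝ} (hf : ∀ θ ∈ Set.Icc (-Real.pi) Real.pi, f (-θ) = f θ)
    (hi : IntervalIntegrable f volume (-Real.pi) Real.pi) :
    ∫ θ in (-Real.pi)..Real.pi, f θ = 2 * ∫ θ in (0 : ℝ)..Real.pi, f θ := by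
  have hp := Real.pi_pos
  rw [← intervalIntegral.integral_add_adjacent_intervals (b := 0)
    (hi.mono_set (by rw [Set.uIcc_of_le (by linarith), Set.uIcc_of_le (by linarith)]
                     exact Set.Icc_subset_Icc_right hp.le))
    (hi.mono_set (by rw [Set.uIcc_of_le (by linarith), Set.uIcc_of_le (by linarith)]
                     exact Set.Icc_subset_Icc_left (by linarith)))]
  have h : ∫ θ in (-Real.pi)..0, f θ = ∫ θ in (0 : ℝ)..Real.pi, f θ := by
    have := intervalIntegral.integral_comp_neg (a := 0) (b := Real.pi) f
    rw [neg_zero] at this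
    rw [← this]
    refine intervalIntegral.integral_congr fun θ hθ => ?_
    rw [Set.uIcc_of_le hp.le] at hθ
    exact hf θ ⟨by linarith [hθ.1], hθ.2⟩
  rw [h, two_mul]

/-- The geometric mean `exp((1/2π) ∫ log S)`. -/
noncomputable def geomMean (S : ℝ → ℝ) : ℝ :=
  Real.exp ((1 / (2 * Real.pi)) * ∫ θ in (-Real.pi)..Real.pi, Real.log (S θ))

/-- A power spectral density that is positive almost everywhere with integrable logarithm. -/
structure IsRegularPSD (S : ℝ → ℝ) : Prop extends IsPSD S where
  pos : ∀ᵐ θ ∂(volume.restrict (Set.Ioc (-Real.pi) Real.pi)), 0 < S θ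
  log_integrable : IntervalIntegrable (fun θ => Real.log (S θ)) volume (-Real.pi) Real.pi

open Polynomial in
lemma circleEval_neg (p : ℝ[X]) (θ : ℝ) :
    circleEval p (-θ) = (starRingEnd ℂ) (circleEval p θ) := by
  rw [circleEval, circleEval, ← Polynomial.aeval_conj, ← Complex.exp_conj]
  simp

lemma integrable_mul_continuous {S f : ℝ → ℝ} (hS : IntervalIntegrable S volume (-Real.pi) Real.pi)
    (hf : Continuous f) :
    IntervalIntegrable (fun θ => f θ * S θ) volume (-Real.pi) Real.pi :=
  hS.continuousOn_mul hf.continuousOn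

open Polynomial in
/-- The hard half of Szegő's theorem. -/
theorem IsRegularPSD.exists_polynomial_integral_lt {S : ℝ → ℝ} (hS : IsRegularPSD S) {ε : ℝ}
    (hε : 0 < ε) :
    ∃ p : ℝ[X], p.coeff 0 = 1 ∧
      (1 / (2 * Real.pi)) * (∫ θ in (-Real.pi)..Real.pi, ‖circleEval p θ‖ ^ 2 * S θ)
        < geomMean S + ε := by
  have hp := Real.pi_pos
  have hsub : Set.Ioc 0 Real.pi ⊆ Set.Ioc (-Real.pi) Real.pi :=
    Set.Ioc_subset_Ioc_left (by linarith)
  have hint : ∀ {f : ℝ → ℝ}, IntervalIntegrable f volume (-Real.pi) Real.pi →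
      Integrable f (volume.restrict (Set.Ioc 0 Real.pi)) := fun h =>
    ((intervalIntegrable_iff_integrableOn_Ioc_of_le (by linarith)).1 h).mono_set hsub
  obtain ⟨p, hp1, hp2⟩ := exists_polynomial_integral_lt_half (hint hS.integrable)
    (ae_restrict_of_ae_restrict_of_subset hsub hS.pos) (hint hS.log_integrable) hε
  refine ⟨p, hp1, ?_⟩
  rw [geomMean, integral_even (fun θ hθ => by rw [hS.even θ hθ]) hS.log_integrable,
    integral_even (f := fun θ => ‖circleEval p θ‖ ^ 2 * S θ) (fun θ hθ => by rw [hS.even θ hθ, circleEval_neg, RCLike.norm_conj])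
      (integrable_mul_continuous hS.integrable ((continuous_circleEval p).norm.pow 2)),
    intervalIntegral.integral_of_le hp.le, intervalIntegral.integral_of_le hp.le]
  have h : ∀ x : ℝ, 1 / (2 * Real.pi) * (2 * x) = Real.pi⁻¹ * x := by
    intro x
    field_simp
  rwa [h, h]

open Polynomial in
-- On (-π, π] the angle is recovered by `Complex.arg`, so the exceptional angles lie in the image of
-- the finite root set.
lemma ae_eval_circle_ne_zero {q : ℂ[X]} (hq : q ≠ 0) :
    ∀ᵐ θ : ℝ ∂(volume.restrict (Set.Ioc (-Real.pi) Real.pi)),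
      q.eval (Complex.exp (θ * Complex.I)) ≠ 0 := by
  rw [ae_restrict_iff' measurableSet_Ioc]
  have hfin : (Complex.arg '' (q.rootSet ℂ)).Finite := (q.rootSet_finite ℂ).image _
  refine measure_mono_null ?_ (hfin.measure_zero volume)
  intro θ hθ
  simp only [Set.mem_compl_iff, Set.mem_ofPred_eq, not_forall, not_not] at hθ
  obtain ⟨hmem, hz⟩ := hθ
  refine ⟨Complex.exp (θ * Complex.I), ?_, ?_⟩
  · rw [mem_rootSet]
    exact ⟨hq, by simpa using hz⟩
  · rw [Complex.arg_exp_mul_I, toIocMod_eq_self]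
    constructor <;> linarith [hmem.1, hmem.2]

open Polynomial in
lemma intervalIntegrable_log_norm_circle (q : ℂ[X]) :
    IntervalIntegrable (fun θ : ℝ => Real.log ‖q.eval (Complex.exp (θ * Complex.I))‖) volume
      (-Real.pi) Real.pi := by
  have h := Polynomial.intervalIntegrable_mahlerMeasure (p := q)
  have hper : Function.Periodic
      (fun θ : ℝ => Real.log ‖q.eval (Complex.exp (θ * Complex.I))‖) (2 * Real.pi) := by
    intro θ
    simp only
    congr 3
    push_cast
    rw [add_mul, Complex.exp_add, Complex.exp_two_pi_mul_I, mul_one]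
  refine hper.intervalIntegrable₀ (by positivity) ?_ _ _
  simpa [circleMap] using h

open Polynomial in
-- The Mahler measure is at least |q(0)| = 1: the coefficient bound has binomial factor 1 at index
-- 0.
lemma integral_log_norm_circle_nonneg {q : ℂ[X]} (hq : q.coeff 0 = 1) :
    0 ≤ ∫ θ in (-Real.pi)..Real.pi, Real.log ‖q.eval (Complex.exp (θ * Complex.I))‖ := by
  have hper : Function.Periodic
      (fun θ : ℝ => Real.log ‖q.eval (Complex.exp (θ * Complex.I))‖) (2 * Real.pi) := by
    intro θ
    simp only
    congr 3
    push_cast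
    rw [add_mul, Complex.exp_add, Complex.exp_two_pi_mul_I, mul_one]
  have h1 := Polynomial.norm_coeff_le_choose_mul_mahlerMeasure 0 q
  rw [hq, norm_one, Nat.choose_zero_right, Nat.cast_one, one_mul] at h1
  have h2 : 0 ≤ q.logMahlerMeasure := by
    rw [logMahlerMeasure_eq_log_MahlerMeasure]
    exact Real.log_nonneg h1
  rw [logMahlerMeasure_def, Real.circleAverage_def, smul_eq_mul] at h2
  have h3 := nonneg_of_mul_nonneg_right h2 (by positivity)
  have h4 := hper.intervalIntegral_add_eq (-Real.pi) 0
  rw [show -Real.pi + 2 * Real.pi = Real.pi by ring, zero_add] at h4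
  rw [h4]
  simpa [circleMap] using h3

open Polynomial in
/-- The easy half of Szegő's theorem. -/
theorem IsRegularPSD.geomMean_le {S : ℝ → ℝ} (hS : IsRegularPSD S) {p : ℝ[X]}
    (hp : p.coeff 0 = 1) :
    geomMean S ≤
      (1 / (2 * Real.pi)) * ∫ θ in (-Real.pi)..Real.pi, ‖circleEval p θ‖ ^ 2 * S θ := by
  have hpi := Real.pi_pos
  have hle : -Real.pi ≤ Real.pi := by linarith
  set q := p.map (algebraMap ℝ ℂ) with hq
  have hpq : ∀ θ, circleEval p θ = q.eval (Complex.exp (θ * Complex.I)) := fun θ => by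
    rw [circleEval, hq, eval_map_algebraMap]
  have hq1 : q.coeff 0 = 1 := by rw [hq, coeff_map, hp, map_one]
  have hq0 : q ≠ 0 := fun h => by simp [h] at hq1
  have h1 := integral_log_norm_circle_nonneg hq1
  have h2 := intervalIntegrable_log_norm_circle q
  have hI : IntervalIntegrable (fun θ => ‖circleEval p θ‖ ^ 2 * S θ) volume (-Real.pi) Real.pi :=
    integrable_mul_continuous hS.integrable ((continuous_circleEval p).norm.pow 2)
  set I := (1 / (2 * Real.pi)) * ∫ θ in (-Real.pi)..Real.pi, ‖circleEval p θ‖ ^ 2 * S θ with hIdef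
  have hzero : ∀ᵐ θ ∂(volume.restrict (Set.Ioc (-Real.pi) Real.pi)), circleEval p θ ≠ 0 := by
    simp_rw [hpq]
    exact ae_eval_circle_ne_zero hq0
  have hpos : ∀ᵐ θ ∂(volume.restrict (Set.Ioc (-Real.pi) Real.pi)),
      0 < ‖circleEval p θ‖ ^ 2 * S θ := by
    filter_upwards [hzero, hS.pos] with θ hθ hθ'
    positivity
  have hIpos : 0 < I := by
    refine mul_pos (by positivity) ?_
    rw [intervalIntegral.integral_of_le hle, integral_pos_iff_support_of_nonneg_ae
      (hpos.mono fun θ h => h.le) ((intervalIntegrable_iff_integrableOn_Ioc_of_le hle).1 hI)]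
    have : (Function.support fun θ => ‖circleEval p θ‖ ^ 2 * S θ)
        =ᵐ[volume.restrict (Set.Ioc (-Real.pi) Real.pi)] Set.univ := by
      rw [ae_eq_univ]
      refine measure_mono_null (fun θ hθ => ?_) (ae_iff.1 hpos)
      intro h
      exact hθ h.ne'
    rw [measure_congr this, Measure.restrict_apply_univ, Real.volume_Ioc]
    simp only [ENNReal.ofReal_pos]
    linarith
  -- Jensen's inequality: log t ≤ t - 1 is integrated at t = |p|² S / I, whose mean is 1. The term 2
  -- log |p| can be dropped later, its integral being nonnegative.
  have hlog : ∫ θ in (-Real.pi)..Real.pi, (2 * Real.log ‖circleEval p θ‖ + Real.log (S θ))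
      ≤ ∫ θ in (-Real.pi)..Real.pi,
        (I⁻¹ * (‖circleEval p θ‖ ^ 2 * S θ) + (Real.log I - 1)) := by
    simp_rw [hpq] at hI hpos ⊢
    refine intervalIntegral.integral_mono_ae_restrict hle ((h2.const_mul 2).add hS.log_integrable)
      ((hI.const_mul _).add intervalIntegrable_const) ?_
    rw [← restrict_Ioc_eq_restrict_Icc]
    filter_upwards [hpos, hS.pos] with θ hθ hθ'
    have hn : 0 < ‖q.eval (Complex.exp (θ * Complex.I))‖ ^ 2 := pos_of_mul_pos_left hθ hθ'.le
    have h5 := Real.log_le_sub_one_of_pos (mul_pos (inv_pos.2 hIpos) hθ)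
    rw [Real.log_mul (inv_pos.2 hIpos).ne' hθ.ne', Real.log_inv, Real.log_mul hn.ne' hθ'.ne',
      Real.log_pow] at h5
    push_cast at h5
    linarith
  simp_rw [hpq] at hI hlog hIdef
  rw [intervalIntegral.integral_add (h2.const_mul 2) hS.log_integrable,
    intervalIntegral.integral_add (hI.const_mul _) intervalIntegrable_const,
    intervalIntegral.integral_const_mul, intervalIntegral.integral_const_mul,
    intervalIntegral.integral_const, smul_eq_mul] at hlog
  rw [geomMean, ← Real.le_log_iff_exp_le hIpos]
  have h6 : ∫ θ in (-Real.pi)..Real.pi, ‖q.eval (Complex.exp (θ * Complex.I))‖ ^ 2 * S θ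
      = 2 * Real.pi * I := by
    rw [hIdef, one_div, mul_inv_cancel_left₀ (by positivity)]
  rw [h6] at hlog
  have h7 : I⁻¹ * (2 * Real.pi * I) = 2 * Real.pi := by field_simp
  rw [h7] at hlog
  rw [one_div, inv_mul_le_iff₀ (by positivity)]
  linarith

end Szego

/-! ### Stationary sequences and prediction errors, with and without feedback -/

section Spectrum

variable {E : Type*} [NormedAddCommGroup E] [InnerProductSpace ℝ E]

/-- `S` is the spectral density of the stationary sequence `x`. -/
def HasSpectrum (S : ℝ → ℝ) (x : ℤ → E) : Prop := ∀ s t : ℤ,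
  inner ℝ (x s) (x t) = (1 / (2 * Real.pi)) *
    ∫ θ in (-Real.pi)..Real.pi, S θ * Real.cos (((t : ℝ) - (s : ℝ)) * θ)

/-- The trigonometric polynomial `∑_{k < N} g_k e^{ikθ}`. -/
noncomputable def trigSum (g : ℕ → ℝ) (N : ℕ) (θ : ℝ) : ℂ :=
  ∑ k ∈ Finset.range N, (g k : ℂ) * Complex.exp (θ * Complex.I) ^ k

lemma continuous_trigSum (g : ℕ → ℝ) (N : ℕ) : Continuous (trigSum g N) := by
  unfold trigSum
  fun_prop

/-- The double sum is the real part of e^{iτθ} A conj(A), where A is the trigonometric sum. -/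
lemma sum_sum_cos (g : ℕ → ℝ) (N : ℕ) (τ θ : ℝ) :
    ∑ k ∈ Finset.range N, ∑ l ∈ Finset.range N,
      g k * g l * Real.cos ((τ + k - l) * θ) = ‖trigSum g N θ‖ ^ 2 * Real.cos (τ * θ) := by
  have h1 : ∀ k l : ℕ, g k * g l * Real.cos ((τ + k - l) * θ)
      = (Complex.exp ((τ * θ : ℝ) * Complex.I) * (((g k : ℂ) * Complex.exp (θ * Complex.I) ^ k)
        * (starRingEnd ℂ) ((g l : ℂ) * Complex.exp (θ * Complex.I) ^ l))).re := by
    intro k l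
    have h2 : Complex.exp ((τ * θ : ℝ) * Complex.I) * (((g k : ℂ) * Complex.exp (θ * Complex.I) ^ k)
        * (starRingEnd ℂ) ((g l : ℂ) * Complex.exp (θ * Complex.I) ^ l))
        = ((g k * g l : ℝ) : ℂ) * Complex.exp (((τ + k - l) * θ : ℝ) * Complex.I) := by
      rw [map_mul, map_pow, ← Complex.exp_conj, Complex.conj_ofReal, map_mul, Complex.conj_ofReal,
        Complex.conj_I, ← Complex.exp_nat_mul, ← Complex.exp_nat_mul]
      have : Complex.exp (((τ + k - l) * θ : ℝ) * Complex.I)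
          = Complex.exp ((τ * θ : ℝ) * Complex.I) * Complex.exp (k * (θ * Complex.I))
            * Complex.exp (l * (θ * -Complex.I)) := by
        rw [← Complex.exp_add, ← Complex.exp_add]
        congr 1
        push_cast
        ring
      rw [this]
      push_cast
      ring
    rw [h2, Complex.re_ofReal_mul, Complex.exp_ofReal_mul_I_re]
  simp_rw [h1, ← Complex.re_sum, ← Finset.mul_sum, ← Finset.sum_mul, ← map_sum]
  rw [← trigSum, Complex.mul_conj, mul_comm, Complex.re_ofReal_mul, Complex.exp_ofReal_mul_I_re,
    Complex.normSq_eq_norm_sq]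

variable {S : ℝ → ℝ} {x : ℤ → E}

lemma HasSpectrum.inner_sum (hx : HasSpectrum S x)
    (hS : IntervalIntegrable S volume (-Real.pi) Real.pi) (g : ℕ → ℝ) (N : ℕ) (s t : ℤ) :
    inner ℝ (∑ k ∈ Finset.range N, g k • x (s - k)) (∑ k ∈ Finset.range N, g k • x (t - k))
      = (1 / (2 * Real.pi)) * ∫ θ in (-Real.pi)..Real.pi,
        ‖trigSum g N θ‖ ^ 2 * S θ * Real.cos (((t : ℝ) - (s : ℝ)) * θ) := by
  have hi : ∀ (a τ : ℝ), IntervalIntegrable (fun θ => a * (S θ * Real.cos (τ * θ))) volume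
      (-Real.pi) Real.pi := fun a τ =>
    (hS.mul_continuousOn (by fun_prop : Continuous fun θ => Real.cos (τ * θ)).continuousOn).const_mul
      a
  simp_rw [sum_inner, _root_.inner_sum, real_inner_smul_left, real_inner_smul_right, hx _ _]
  have h1 : ∀ k l : ℕ, g k * (g l * ((1 / (2 * Real.pi)) * ∫ θ in (-Real.pi)..Real.pi,
      S θ * Real.cos ((((t - l : ℤ) : ℝ) - ((s - k : ℤ) : ℝ)) * θ)))
      = (1 / (2 * Real.pi)) * ∫ θ in (-Real.pi)..Real.pi,
        g k * g l * (S θ * Real.cos ((((t : ℝ) - s) + k - l) * θ)) := by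
    intro k l
    rw [intervalIntegral.integral_const_mul]
    have : ((t - l : ℤ) : ℝ) - ((s - k : ℤ) : ℝ) = ((t : ℝ) - s) + k - l := by push_cast; ring
    rw [this]
    ring
  simp_rw [h1, ← Finset.mul_sum]
  congr 1
  have h2 : ∀ k ∈ Finset.range N, ∑ l ∈ Finset.range N, ∫ θ in (-Real.pi)..Real.pi,
        g k * g l * (S θ * Real.cos ((((t : ℝ) - s) + k - l) * θ))
      = ∫ θ in (-Real.pi)..Real.pi, ∑ l ∈ Finset.range N,
        g k * g l * (S θ * Real.cos ((((t : ℝ) - s) + k - l) * θ)) := fun k _ =>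
    (intervalIntegral.integral_finsetSum fun l _ => hi _ _).symm
  rw [Finset.sum_congr rfl h2, ← intervalIntegral.integral_finsetSum]
  · refine intervalIntegral.integral_congr fun θ _ => ?_
    have := sum_sum_cos g N ((t : ℝ) - s) θ
    rw [mul_assoc, mul_left_comm, ← this, Finset.mul_sum]
    refine Finset.sum_congr rfl fun k _ => ?_
    rw [Finset.mul_sum]
    refine Finset.sum_congr rfl fun l _ => ?_
    ring
  · intro k _
    have := IntervalIntegrable.sum (Finset.range N) (f := fun l θ =>
      g k * g l * (S θ * Real.cos ((((t : ℝ) - s) + k - l) * θ))) (fun l _ => hi (g k * g l) _)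
    simpa [Finset.sum_fn] using this

/-- The spectral density of the output of a filter with absolutely summable impulse response. -/
lemma HasSpectrum.of_tendsto (hx : HasSpectrum S x)
    (hS : IntervalIntegrable S volume (-Real.pi) Real.pi) {g : ℕ → ℝ} (hg : Summable fun k => |g k|)
    {F : ℝ → ℂ} (hF : ∀ θ, Tendsto (fun N => ‖trigSum g N θ‖) atTop (𝓝 ‖F θ‖)) {y : ℤ → E}
    (hy : ∀ t : ℤ, Tendsto (fun N => ∑ k ∈ Finset.range N, g k • x (t - k)) atTop (𝓝 (y t))) :
    HasSpectrum (fun θ => ‖F θ‖ ^ 2 * S θ) y := by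
  intro s t
  refine tendsto_nhds_unique ((hy s).inner (hy t)) ?_
  simp_rw [hx.inner_sum hS]
  refine Tendsto.const_mul _ ?_
  have hb : ∀ N θ, ‖trigSum g N θ‖ ≤ ∑' k, |g k| := by
    intro N θ
    rw [trigSum]
    refine (norm_sum_le _ _).trans ?_
    refine le_trans (le_of_eq ?_) (hg.sum_le_tsum (Finset.range N) fun k _ => abs_nonneg _)
    refine Finset.sum_congr rfl fun k _ => ?_
    rw [norm_mul, norm_pow, Complex.norm_exp_ofReal_mul_I, one_pow, mul_one, Complex.norm_real,
      Real.norm_eq_abs]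
  refine intervalIntegral.tendsto_integral_filter_of_dominated_convergence
    (fun θ => (∑' k, |g k|) ^ 2 * |S θ|) (Eventually.of_forall fun N => ?_)
    (Eventually.of_forall fun N => ae_of_all _ fun θ _ => ?_) (hS.abs.const_mul _)
    (ae_of_all _ fun θ _ => ?_)
  · exact ((((continuous_trigSum g N).norm.pow 2).aestronglyMeasurable.mul
      hS.aestronglyMeasurable_restrict_uIoc)).mul
      (by fun_prop : Continuous fun θ => Real.cos (((t : ℝ) - s) * θ)).aestronglyMeasurable
  · rw [norm_mul, norm_mul, Real.norm_of_nonneg (by positivity : 0 ≤ ‖trigSum g N θ‖ ^ 2),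
      Real.norm_eq_abs, Real.norm_eq_abs]
    calc _ ≤ (∑' k, |g k|) ^ 2 * |S θ| * 1 := by
          gcongr
          · exact hb N θ
          · exact Real.abs_cos_le_one _
      _ = _ := mul_one _
  · exact (((hF θ).pow 2).mul_const _).mul_const _

lemma HasSpectrum.add {S' : ℝ → ℝ} {y : ℤ → E} (hx : HasSpectrum S x) (hy : HasSpectrum S' y)
    (hS : IntervalIntegrable S volume (-Real.pi) Real.pi)
    (hS' : IntervalIntegrable S' volume (-Real.pi) Real.pi)
    (hxy : ∀ s t, inner ℝ (x s) (y t) = 0) :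
    HasSpectrum (fun θ => S θ + S' θ) (fun t => x t + y t) := by
  intro s t
  have hc : Continuous fun θ : ℝ => Real.cos (((t : ℝ) - s) * θ) := by fun_prop
  simp_rw [inner_add_left, inner_add_right, hxy, real_inner_comm (x t) (y s), hxy, add_mul]
  rw [intervalIntegral.integral_add (hS.mul_continuousOn hc.continuousOn)
    (hS'.mul_continuousOn hc.continuousOn), mul_add, ← hx, ← hy, add_zero, zero_add]

open Polynomial in
/-- The moving average `∑ p_k x_{t-k}`. -/
noncomputable def movingAverage (x : ℤ → E) (t : ℤ) (p : ℝ[X]) : E :=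
  p.sum fun k a => a • x (t - k)

open Polynomial in
lemma movingAverage_eq (x : ℤ → E) (t : ℤ) (p : ℝ[X]) :
    movingAverage x t p = ∑ k ∈ Finset.range (p.natDegree + 1), p.coeff k • x (t - k) :=
  p.sum_over_range fun _ => zero_smul _ _

open Polynomial in
lemma circleEval_eq_trigSum (p : ℝ[X]) (θ : ℝ) :
    circleEval p θ = trigSum p.coeff (p.natDegree + 1) θ := by
  rw [circleEval, aeval_eq_sum_range, trigSum]
  simp

open Polynomial in
lemma HasSpectrum.norm_movingAverage_sq (hx : HasSpectrum S x)
    (hS : IntervalIntegrable S volume (-Real.pi) Real.pi) (t : ℤ) (p : ℝ[X]) :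
    ‖movingAverage x t p‖ ^ 2
      = (1 / (2 * Real.pi)) * ∫ θ in (-Real.pi)..Real.pi, ‖circleEval p θ‖ ^ 2 * S θ := by
  rw [← real_inner_self_eq_norm_sq, movingAverage_eq, hx.inner_sum hS]
  simp [circleEval_eq_trigSum]

/-- The closed linear span of the past `x_{t-1}, x_{t-2}, …`. -/
noncomputable def past (x : ℤ → E) (t : ℤ) : Submodule ℝ E :=
  (Submodule.span ℝ (Set.range fun j : ℕ => x (t - 1 - j))).topologicalClosure

lemma mem_past {s t : ℤ} (h : s < t) : x s ∈ past x t := by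
  refine Submodule.le_topologicalClosure _ (Submodule.subset_span ⟨(t - 1 - s).toNat, ?_⟩)
  simp only
  congr 1
  omega

lemma past_mono {s t : ℤ} (h : s ≤ t) : past x s ≤ past x t := by
  refine Submodule.topologicalClosure_minimal _ (Submodule.span_le.2 ?_)
    (Submodule.isClosed_topologicalClosure _)
  rintro _ ⟨j, rfl⟩
  exact mem_past (by omega)

open Polynomial in
-- Adding to x_t an element of the span is a moving average by a polynomial with constant
-- coefficient 1, to which the easy half of Szegő's theorem applies; the bound survives closure.
lemma HasSpectrum.geomMean_le_norm_sq (hx : HasSpectrum S x) (hS : IsRegularPSD S) (t : ℤ)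
    {k : E} (hk : k ∈ past x t) : geomMean S ≤ ‖x t + k‖ ^ 2 := by
  have hcl : IsClosed {k : E | geomMean S ≤ ‖x t + k‖ ^ 2} :=
    isClosed_le continuous_const (by fun_prop)
  refine closure_minimal ?_ hcl hk
  intro k hk
  obtain ⟨c, rfl⟩ := Finsupp.mem_span_range_iff_exists_finsupp.1 hk
  set p : ℝ[X] := monomial 0 1 + ∑ j ∈ c.support, monomial (j + 1) (c j) with hp
  have hp0 : p.coeff 0 = 1 := by
    simp [hp, finsetSum_coeff, coeff_monomial]
  have hadd : ∀ p q : ℝ[X], movingAverage x t (p + q) = movingAverage x t p + movingAverage x t q :=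
    fun p q => sum_add_index _ _ _ (fun _ => zero_smul _ _) (fun _ _ _ => add_smul _ _ _)
  have hmon : ∀ n a, movingAverage x t (monomial n a) = a • x (t - n) := fun n a =>
    sum_monomial_index _ _ (zero_smul _ _)
  let Φ : ℝ[X] →+ E := AddMonoidHom.mk' (movingAverage x t) hadd
  have hΦ : movingAverage x t p = x t + c.sum fun i a => a • x (t - 1 - i) := by
    change Φ p = _
    rw [hp, map_add, map_sum, Finsupp.sum]
    congr 1
    · exact (hmon 0 1).trans (by simp)
    · refine Finset.sum_congr rfl fun j _ => (hmon (j + 1) (c j)).trans ?_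
      congr 2
      push_cast
      ring
  change geomMean S ≤ ‖x t + _‖ ^ 2
  rw [← hΦ, hx.norm_movingAverage_sq hS.integrable]
  exact hS.geomMean_le hp0

open Polynomial in
-- By stationarity a single predictor of finite length serves all times t, so it fits into any
-- sufficiently long block starting at time 1.
lemma HasSpectrum.exists_norm_sq_lt (hx : HasSpectrum S x) (hS : IsRegularPSD S) {ε : ℝ}
    (hε : 0 < ε) : ∃ (N : ℕ) (c : ℕ → ℝ), ∀ t : ℤ,
      ‖x t + ∑ k ∈ Finset.range N, c k • x (t - 1 - k)‖ ^ 2 < geomMean S + ε := by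
  obtain ⟨p, hp0, hp⟩ := hS.exists_polynomial_integral_lt hε
  refine ⟨p.natDegree, fun k => p.coeff (k + 1), fun t => ?_⟩
  rw [← hx.norm_movingAverage_sq hS.integrable t, movingAverage_eq, Finset.sum_range_succ',
    hp0] at hp
  convert hp using 3
  rw [add_comm]
  congr 1
  · refine Finset.sum_congr rfl fun k _ => ?_
    congr 2
    push_cast
    ring
  · simp

lemma tendsto_infDist_sq {x : ℕ → E} {K : ℕ → Submodule ℝ E} {m : ℝ}
    (hlow : ∀ n, ∀ k ∈ K n, m ≤ ‖x n + k‖ ^ 2)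
    (hup : ∀ ε > 0, ∃ N, ∀ n ≥ N, ∃ k ∈ K n, ‖x n + k‖ ^ 2 < m + ε) :
    (∀ n, m ≤ Metric.infDist (x n) (K n) ^ 2) ∧
      Tendsto (fun n => Metric.infDist (x n) (K n) ^ 2) atTop (𝓝 m) := by
  have h1 : ∀ n, m ≤ Metric.infDist (x n) (K n) ^ 2 := by
    intro n
    refine (Real.sqrt_le_left Metric.infDist_nonneg).1 ?_
    refine (Metric.le_infDist ⟨0, (K n).zero_mem⟩).2 fun k hk => ?_
    rw [dist_eq_norm, sub_eq_add_neg]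
    exact Real.sqrt_le_iff.2 ⟨norm_nonneg _, hlow n _ ((K n).neg_mem hk)⟩
  refine ⟨h1, ?_⟩
  rw [Metric.tendsto_atTop]
  intro ε hε
  obtain ⟨N, hN⟩ := hup ε hε
  refine ⟨N, fun n hn => ?_⟩
  obtain ⟨k, hk, hlt⟩ := hN n hn
  have h2 : Metric.infDist (x n) (K n) ≤ ‖x n + k‖ := by
    have := Metric.infDist_le_dist_of_mem (x := x n) ((K n).neg_mem hk)
    rwa [dist_eq_norm, sub_neg_eq_add] at this
  have h3 : Metric.infDist (x n) (K n) ^ 2 ≤ ‖x n + k‖ ^ 2 := by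
    gcongr
    exact Metric.infDist_nonneg
  rw [Real.dist_eq, abs_lt]
  constructor <;> linarith [h1 n]

/-- The one-step prediction error is bounded below by and converges to the geometric mean of the spectral density. -/
theorem HasSpectrum.tendsto_infDist_sq (hx : HasSpectrum S x) (hS : IsRegularPSD S) :
    (∀ n : ℕ, geomMean S ≤ Metric.infDist (x (n + 1))
      (Submodule.span ℝ (Set.range fun i : Fin n => x (i + 1)) : Set E) ^ 2) ∧
    Tendsto (fun n : ℕ => Metric.infDist (x (n + 1))
      (Submodule.span ℝ (Set.range fun i : Fin n => x (i + 1)) : Set E) ^ 2) atTop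
      (𝓝 (geomMean S)) := by
  refine FeedbackCapacity.tendsto_infDist_sq (x := fun n => x (n + 1))
    (K := fun n => Submodule.span ℝ (Set.range fun i : Fin n => x (i + 1)))
    (fun n k hk => ?_) (fun ε hε => ?_)
  · refine hx.geomMean_le_norm_sq hS _ (Submodule.span_le.2 ?_ hk)
    rintro _ ⟨i, rfl⟩
    exact mem_past (by have := i.2; omega)
  · obtain ⟨N, c, hc⟩ := hx.exists_norm_sq_lt hS hε
    refine ⟨N, fun n hn => ⟨_, ?_, hc (n + 1)⟩⟩
    refine Submodule.sum_mem _ fun k hk => Submodule.smul_mem _ _ (Submodule.subset_span ?_)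
    have hk' := Finset.mem_range.1 hk
    refine ⟨⟨n - 1 - k, by omega⟩, ?_⟩
    simp only
    congr 1
    omega

/-- The prediction error of `y = u + w` from the past outputs and the inputs, when the inputs are
a strictly causal function of `w` plus a component orthogonal to `w`. -/
theorem HasSpectrum.tendsto_infDist_sq_feedback {w u y a b : ℤ → E} (hw : HasSpectrum S w)
    (hS : IsRegularPSD S) (hy : ∀ t, y t = u t + w t) (hu : ∀ t, u t = a t + b t)
    (ha : ∀ t, a t ∈ past w t) {V : Submodule ℝ E} (hb : ∀ t, b t ∈ V)
    (hV : ∀ t, ∀ v ∈ V, inner ℝ (w t) v = 0) :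
    (∀ n : ℕ, geomMean S ≤ Metric.infDist (y (n + 1))
      (Submodule.span ℝ (Set.range (Sum.elim (fun i : Fin n => y (i + 1))
        (fun i : Fin (n + 1) => u (i + 1)))) : Set E) ^ 2) ∧
    Tendsto (fun n : ℕ => Metric.infDist (y (n + 1))
      (Submodule.span ℝ (Set.range (Sum.elim (fun i : Fin n => y (i + 1))
        (fun i : Fin (n + 1) => u (i + 1)))) : Set E) ^ 2) atTop (𝓝 (geomMean S)) := by
  refine FeedbackCapacity.tendsto_infDist_sq (x := fun n => y (n + 1))
    (K := fun n => Submodule.span ℝ (Set.range (Sum.elim (fun i : Fin n => y (i + 1))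
        (fun i : Fin (n + 1) => u (i + 1))))) (fun n k hk => ?_) (fun ε hε => ?_)
  · have hKle : Submodule.span ℝ (Set.range (Sum.elim (fun i : Fin n => y (i + 1))
        (fun i : Fin (n + 1) => u (i + 1)))) ≤ past w (n + 1) ⊔ V := by
      have hu' : ∀ t ≤ (n + 1 : ℤ), u t ∈ past w (n + 1) ⊔ V := fun t ht => by
        rw [hu]
        exact Submodule.add_mem _ (Submodule.mem_sup_left (past_mono ht (ha t)))
          (Submodule.mem_sup_right (hb t))
      refine Submodule.span_le.2 ?_
      rintro _ ⟨i | i, rfl⟩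
      · simp only [Sum.elim_inl, hy]
        have := i.2
        exact Submodule.add_mem _ (hu' _ (by omega))
          (Submodule.mem_sup_left (mem_past (by omega)))
      · have := i.2
        exact hu' _ (by omega)
    obtain ⟨a', ha', b', hb', rfl⟩ := Submodule.mem_sup.1 (hKle hk)
    have horth : ∀ z ∈ past w (n + 1), ∀ v ∈ V, inner ℝ z v = 0 := by
      intro z hz v hv
      have hcl : IsClosed {z : E | inner ℝ z v = 0} :=
        isClosed_eq (by fun_prop) continuous_const
      refine closure_minimal ?_ hcl hz
      intro z hz
      induction hz using Submodule.span_induction with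
      | mem z hz => obtain ⟨j, rfl⟩ := hz; exact hV _ v hv
      | zero => exact inner_zero_left _
      | add z z' _ _ h h' =>
        change inner ℝ (z + z') v = 0
        rw [inner_add_left, h, h', add_zero]
      | smul c z _ h =>
        change inner ℝ (c • z) v = 0
        rw [real_inner_smul_left, h, mul_zero]
    -- The error is w_{n+1} plus an element of its past, plus an element of V orthogonal to both; by
    -- Pythagoras the V part only increases the norm.
    have h1 : y (n + 1) + (a' + b') = (w (n + 1) + (a (n + 1) + a')) + (b (n + 1) + b') := by
      rw [hy, hu]
      abel
    have hbV : b (n + 1) + b' ∈ V := V.add_mem (hb _) hb'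
    have haP : a (n + 1) + a' ∈ past w (n + 1) := Submodule.add_mem _ (ha _) ha'
    have h2 : inner ℝ (w (n + 1) + (a (n + 1) + a')) (b (n + 1) + b') = 0 := by
      rw [inner_add_left, hV _ _ hbV, horth _ haP _ hbV, add_zero]
    rw [h1, sq, norm_add_sq_eq_norm_sq_add_norm_sq_real h2]
    have h3 := hw.geomMean_le_norm_sq hS (n + 1) haP
    nlinarith [norm_nonneg (b (n + 1) + b')]
  · obtain ⟨N, c, hc⟩ := hw.exists_norm_sq_lt hS hε
    -- Since y - u = w, the current input is subtracted and the predictor of w is applied to the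
    -- past differences; n ≥ N keeps the indices in the block.
    refine ⟨N, fun n hn => ⟨-u (n + 1) + ∑ k ∈ Finset.range N,
      c k • (y (n + 1 - 1 - k) - u (n + 1 - 1 - k)), ?_, ?_⟩⟩
    · have hu' : ∀ i : ℕ, i < n + 1 → u (i + 1) ∈ Submodule.span ℝ
          (Set.range (Sum.elim (fun i : Fin n => y (i + 1))
            (fun i : Fin (n + 1) => u (i + 1)))) := fun i hi =>
        Submodule.subset_span ⟨Sum.inr ⟨i, hi⟩, rfl⟩
      have hy' : ∀ i : ℕ, i < n → y (i + 1) ∈ Submodule.span ℝ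
          (Set.range (Sum.elim (fun i : Fin n => y (i + 1))
            (fun i : Fin (n + 1) => u (i + 1)))) := fun i hi =>
        Submodule.subset_span ⟨Sum.inl ⟨i, hi⟩, rfl⟩
      refine Submodule.add_mem _ (Submodule.neg_mem _ (hu' n (by omega)))
        (Submodule.sum_mem _ fun k hk => Submodule.smul_mem _ _ ?_)
      have hk' := Finset.mem_range.1 hk
      have h4 : (n + 1 - 1 - k : ℤ) = ((n - 1 - k : ℕ) : ℤ) + 1 := by omega
      rw [h4]
      exact Submodule.sub_mem _ (hy' _ (by omega)) (hu' _ (by omega))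
    · have h5 : y (n + 1) + (-u (n + 1) + ∑ k ∈ Finset.range N,
          c k • (y (n + 1 - 1 - k) - u (n + 1 - 1 - k)))
          = w (n + 1) + ∑ k ∈ Finset.range N, c k • w (n + 1 - 1 - k) := by
        simp only [hy, add_sub_cancel_left]
        abel
      rw [h5]
      exact hc (n + 1)

end Spectrum

/-! ### Stable transfer functions, impulse responses and Youla parameters -/

section TransferFunctions

variable {G Q K : RatFunc ℝ}

lemma evalAt_eq (G : RatFunc ℝ) (z : ℂ) :
    evalAt G z = Polynomial.aeval z G.num / Polynomial.aeval z G.denom := rfl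

lemma IsRHInfty.aeval_denom_ne_zero (hG : IsRHInfty G) {z : ℂ} (hz : 1 ≤ ‖z‖) :
    Polynomial.aeval z G.denom ≠ 0 := fun h => (hG.2 z h).not_ge hz

lemma norm_exp_mul_I (θ : ℝ) : ‖Complex.exp (θ * Complex.I)‖ = 1 :=
  Complex.norm_exp_ofReal_mul_I θ

lemma IsRHInfty.continuous_freqResp (hG : IsRHInfty G) : Continuous (freqResp G) := by
  unfold freqResp
  simp_rw [evalAt_eq]
  exact Continuous.div (by fun_prop) (by fun_prop)
    fun θ => hG.aeval_denom_ne_zero (norm_exp_mul_I θ).ge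

lemma evalAt_conj (G : RatFunc ℝ) (z : ℂ) :
    evalAt G ((starRingEnd ℂ) z) = (starRingEnd ℂ) (evalAt G z) := by
  rw [evalAt_eq, evalAt_eq, map_div₀, Polynomial.aeval_conj, Polynomial.aeval_conj]

lemma freqResp_neg (G : RatFunc ℝ) (θ : ℝ) :
    freqResp G (-θ) = (starRingEnd ℂ) (freqResp G θ) := by
  rw [freqResp, freqResp, ← evalAt_conj, ← Complex.exp_conj]
  simp

open Polynomial in
-- Reversing numerator and denominator at the same m turns G(z) into a function of the delay 1/z.
lemma aeval_reflect {p : ℝ[X]} {m : ℕ} (hp : p.natDegree ≤ m) {z : ℂ} (hz : z ≠ 0) :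
    aeval z⁻¹ (p.reflect m) = aeval z p * (z ^ m)⁻¹ := by
  have : Invertible z := invertibleOfNonzero hz
  have h := eval₂_reflect_mul_pow (algebraMap ℝ ℂ) z m p hp
  rw [invOf_eq_inv] at h
  rw [aeval_def, aeval_def, ← h]
  field_simp

open Polynomial in
/-- A stable proper transfer function has an impulse response. -/
theorem IsRHInfty.exists_isImpulseResponse (hG : IsRHInfty G) :
    ∃ g : ℕ → ℝ, IsImpulseResponse G g := by
  set m := G.denom.natDegree with hm
  set N := G.num.reflect m with hN
  set D := G.denom.reflect m with hD
  have hdeg : G.num.natDegree ≤ m := natDegree_le_natDegree hG.1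
  set f : ℂ → ℂ := fun x => aeval x N / aeval x D with hf
  have hfG : ∀ z : ℂ, z ≠ 0 → evalAt G z = f z⁻¹ := by
    intro z hz
    rw [hf, evalAt_eq]
    simp only
    rw [aeval_reflect hdeg hz, aeval_reflect hm.symm.le hz, mul_div_mul_right]
    exact inv_ne_zero (pow_ne_zero _ hz)
  have hD0 : ∀ x ∈ Metric.closedBall (0 : ℂ) 1, aeval x D ≠ 0 := by
    intro x hx
    rw [mem_closedBall_zero_iff] at hx
    -- At x = 0, that is z = ∞, the reversed denominator equals the leading coefficient 1; elsewhere
    -- in the disc, |1/x| ≥ 1 excludes poles.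
    by_cases h0 : x = 0
    · rw [h0, ← coeff_zero_eq_aeval_zero', hD, coeff_reflect]
      simp [hm, revAt_le, RatFunc.monic_denom G]
    · rw [← inv_inv x, aeval_reflect hm.symm.le (inv_ne_zero h0)]
      refine mul_ne_zero (hG.aeval_denom_ne_zero ?_) (inv_ne_zero (pow_ne_zero _ (inv_ne_zero h0)))
      rw [norm_inv]
      exact (one_le_inv₀ (norm_pos_iff.2 h0)).2 hx
  -- Compactness gives analyticity on a disc of radius 1 + δ, hence convergence of the series on the
  -- circle |z| = 1 itself.
  have hopen : IsOpen {x : ℂ | aeval x D ≠ 0} := isOpen_ne_fun (by fun_prop) continuous_const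
  obtain ⟨δ, hδ, hsub⟩ := (isCompact_closedBall (0 : ℂ) 1).exists_cthickening_subset_open hopen hD0
  rw [cthickening_closedBall hδ.le zero_le_one] at hsub
  have hdiff : DifferentiableOn ℂ f (Metric.closedBall 0 (δ + 1)) := by
    refine DifferentiableOn.div ?_ ?_ fun x hx => hsub hx
    · exact (Polynomial.differentiable_aeval N).differentiableOn
    · exact (Polynomial.differentiable_aeval D).differentiableOn
  lift δ + 1 to NNReal using by positivity with R hR
  have hR1 : 1 < (R : ℝ) := by rw [hR]; linarith
  have hps := hdiff.hasFPowerSeriesOnBall (by exact_mod_cast zero_lt_one.trans hR1)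
  set c : ℕ → ℂ := fun k => (cauchyPowerSeries f 0 R).coeff k with hc
  have hsum : ∀ x : ℂ, ‖x‖ ≤ 1 → HasSum (fun k => c k * x ^ k) (f x) := by
    intro x hx
    have hxR : x ∈ Metric.eball (0 : ℂ) R := by
      rw [Metric.mem_eball, edist_zero_right, enorm_eq_nnnorm]
      exact_mod_cast lt_of_le_of_lt hx hR1
    have h := hps.hasSum hxR
    rw [zero_add] at h
    refine (funext fun k => ?_ : (fun k => c k * x ^ k) = _) ▸ h
    rw [FormalMultilinearSeries.apply_eq_pow_smul_coeff, smul_eq_mul, mul_comm]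
  have hfconj : ∀ x, f ((starRingEnd ℂ) x) = (starRingEnd ℂ) (f x) := by
    intro x
    simp only [hf, aeval_conj, map_div₀]
  -- As f commutes with conjugation, averaging its series with the conjugate series at the conjugate
  -- point replaces the coefficients by their real parts.
  refine ⟨fun k => (c k).re, fun z hz => ?_⟩
  have hz0 : z ≠ 0 := norm_pos_iff.1 (zero_lt_one.trans_le hz)
  have hz1 : ‖z⁻¹‖ ≤ 1 := by rw [norm_inv]; exact inv_le_one_of_one_le₀ hz
  rw [hfG z hz0]
  have h1 := hsum z⁻¹ hz1
  have h2 := Complex.hasSum_conj'.2 (hsum ((starRingEnd ℂ) z⁻¹) (by rwa [RCLike.norm_conj]))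
  rw [hfconj, Complex.conj_conj] at h2
  have h3 := (h1.add h2).div_const 2
  rw [← two_mul, mul_div_cancel_left₀ _ two_ne_zero] at h3
  refine (funext fun k => ?_ : (fun k => ((c k).re : ℂ) * (z ^ k)⁻¹) = _) ▸ h3
  rw [map_mul, map_pow, Complex.conj_conj, ← add_mul, Complex.add_conj, inv_pow]
  push_cast
  ring

lemma IsImpulseResponse.summable {g : ℕ → ℝ} (hg : IsImpulseResponse G g) :
    Summable fun k => |g k| := by
  have h := (hg 1 (by simp)).summable.norm
  simpa using h

/-- The sums use e^{ikθ} where the transform uses z^{-k}, hence -θ; the sign is harmless, since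
spectra involve only moduli. -/
lemma IsImpulseResponse.tendsto_trigSum {g : ℕ → ℝ} (hg : IsImpulseResponse G g) (θ : ℝ) :
    Tendsto (fun N => trigSum g N θ) atTop (𝓝 (freqResp G (-θ))) := by
  refine (hg _ (norm_exp_mul_I (-θ)).ge).tendsto_sum_nat.congr fun N => ?_
  rw [trigSum]
  refine Finset.sum_congr rfl fun k _ => ?_
  rw [← inv_pow, ← Complex.exp_neg]
  simp

lemma norm_freqResp_neg (G : RatFunc ℝ) (θ : ℝ) : ‖freqResp G (-θ)‖ = ‖freqResp G θ‖ := by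
  rw [freqResp_neg, RCLike.norm_conj]

open Polynomial in
-- As z tends to infinity along the reals, the series tends to its first term by dominated
-- convergence, and G(z) tends to 0.
lemma IsImpulseResponse.zero_of_isStrictlyProper {g : ℕ → ℝ} (hg : IsImpulseResponse G g)
    (hG : IsStrictlyProper G) : g 0 = 0 := by
  have h1 : Tendsto (fun x : ℝ => evalAt G (x : ℂ)) atTop (𝓝 0) := by
    have h := Polynomial.div_tendsto_atTop_zero_of_degree_lt G.num G.denom hG
    have h2 := (Complex.continuous_ofReal.tendsto 0).comp h
    rw [Complex.ofReal_zero] at h2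
    refine h2.congr fun x => ?_
    have hx : ∀ p : ℝ[X], aeval (x : ℂ) p = ((p.eval x : ℝ) : ℂ) := fun p => by
      simpa using aeval_algebraMap_apply ℂ x p
    rw [evalAt_eq, hx, hx]
    simp
  have h2 : Tendsto (fun x : ℝ => ∑' k, (g k : ℂ) * ((x : ℂ) ^ k)⁻¹) atTop
      (𝓝 (∑' k, if k = 0 then (g 0 : ℂ) else 0)) := by
    refine tendsto_tsum_of_dominated_convergence (bound := fun k => |g k|) hg.summable ?_ ?_
    · intro k
      by_cases hk : k = 0
      · subst hk
        simp
      · rw [if_neg hk]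
        have h3 : Tendsto (fun x : ℝ => ((x ^ k)⁻¹ : ℝ)) atTop (𝓝 0) :=
          (tendsto_pow_atTop hk).inv_tendsto_atTop
        have h4 := ((Complex.continuous_ofReal.tendsto 0).comp h3).const_mul (g k : ℂ)
        simpa [Function.comp_def] using h4
    · filter_upwards [eventually_ge_atTop 1] with x hx k
      rw [norm_mul, Complex.norm_real, Real.norm_eq_abs, norm_inv, norm_pow, Complex.norm_real,
        Real.norm_of_nonneg (by linarith)]
      exact mul_le_of_le_one_right (abs_nonneg _) (inv_le_one_of_one_le₀ (one_le_pow₀ hx))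
  rw [tsum_ite_eq] at h2
  have h3 : (g 0 : ℂ) = 0 := by
    refine tendsto_nhds_unique (h2.congr' ?_) h1
    filter_upwards [eventually_ge_atTop 1] with x hx
    refine (hg x ?_).tsum_eq
    rwa [Complex.norm_real, Real.norm_of_nonneg (by linarith)]
  exact_mod_cast h3

lemma isProper_iff (hG : G ≠ 0) : IsProper G ↔ G.intDegree ≤ 0 := by
  rw [IsProper, Polynomial.degree_eq_natDegree (RatFunc.num_ne_zero hG),
    Polynomial.degree_eq_natDegree G.denom_ne_zero, RatFunc.intDegree]
  rw [Nat.cast_le]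
  omega

lemma isStrictlyProper_iff (hG : G ≠ 0) : IsStrictlyProper G ↔ G.intDegree < 0 := by
  rw [IsStrictlyProper, Polynomial.degree_eq_natDegree (RatFunc.num_ne_zero hG),
    Polynomial.degree_eq_natDegree G.denom_ne_zero, RatFunc.intDegree]
  rw [Nat.cast_lt]
  omega

lemma isStrictlyProper_zero : IsStrictlyProper 0 := by
  simp [IsStrictlyProper]

lemma IsStrictlyProper.neg (hG : IsStrictlyProper G) : IsStrictlyProper (-G) := by
  by_cases h : G = 0
  · simpa [h] using isStrictlyProper_zero
  · rw [isStrictlyProper_iff (neg_ne_zero.2 h), RatFunc.intDegree_neg]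
    exact (isStrictlyProper_iff h).1 hG

lemma IsStrictlyProper.one_add_ne_zero (hG : IsStrictlyProper G) : 1 + G ≠ 0 := by
  intro h
  have h1 : G = -1 := by linear_combination h
  have h2 := (isStrictlyProper_iff (by rw [h1]; simp)).1 hG
  rw [h1, RatFunc.intDegree_neg, RatFunc.intDegree_one] at h2
  exact lt_irrefl _ h2

/-- The degree of a sum gives one inequality; writing 1 = -G + (1 + G) gives the other. -/
lemma IsStrictlyProper.intDegree_one_add (hG : IsStrictlyProper G) :
    (1 + G).intDegree = 0 := by
  by_cases h : G = 0
  · simp [h]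
  have h1 := hG.one_add_ne_zero
  have h2 := (isStrictlyProper_iff h).1 hG
  have h3 := RatFunc.intDegree_add_le h h1
  rw [RatFunc.intDegree_one] at h3
  have h4 : -G + (1 + G) ≠ 0 := by simp
  have h5 := RatFunc.intDegree_add_le h1 h4
  rw [RatFunc.intDegree_neg, neg_add_cancel_comm_assoc, RatFunc.intDegree_one] at h5
  omega

lemma IsStrictlyProper.div_one_add (hG : IsStrictlyProper G) :
    IsStrictlyProper (G / (1 + G)) := by
  by_cases h : G = 0
  · simpa [h] using isStrictlyProper_zero
  rw [isStrictlyProper_iff (div_ne_zero h hG.one_add_ne_zero),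
    RatFunc.intDegree_div h hG.one_add_ne_zero, hG.intDegree_one_add, sub_zero]
  exact (isStrictlyProper_iff h).1 hG

lemma IsStrictlyProper.div_one_sub (hG : IsStrictlyProper G) :
    IsStrictlyProper (G / (1 - G)) := by
  have h := hG.neg.div_one_add.neg
  rwa [← sub_eq_add_neg, neg_div, neg_neg] at h

lemma isRHInfty_one : IsRHInfty 1 := by
  refine ⟨by simp [IsProper], fun z hz => ?_⟩
  simp at hz

lemma IsRHInfty.one_add (hQ : IsRHInfty Q) (hQ' : IsStrictlyProper Q) : IsRHInfty (1 + Q) := by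
  refine ⟨(isProper_iff hQ'.one_add_ne_zero).2 hQ'.intDegree_one_add.le, fun z hz => hQ.2 z ?_⟩
  obtain ⟨r, hr⟩ := RatFunc.denom_add_dvd 1 Q
  rw [RatFunc.denom_one, one_mul] at hr
  rw [hr, map_mul, hz, zero_mul]

/-- The controller with Youla parameters `[1, Q]` is stabilising. -/
lemma isStabilizing_youla (hQ : IsRHInfty Q) (hQ' : IsStrictlyProper Q) :
    IsStabilizing 1 (1 / (1 + Q)) (Q / (1 + Q)) := by
  have h := hQ'.one_add_ne_zero
  have h1 : 1 - 1 * (Q / (1 + Q)) = 1 / (1 + Q) := by field_simp; ring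
  have h2 : 1 / (1 / (1 + Q)) = 1 + Q := by field_simp
  have h3 : 1 / (1 + Q) / (1 / (1 + Q)) = 1 := by field_simp
  have h4 : Q / (1 + Q) / (1 / (1 + Q)) = Q := by field_simp
  refine ⟨?_, ?_, ?_, ?_, ?_, ?_, ?_⟩ <;> rw [h1]
  · exact one_div_ne_zero h
  · rw [h3]; exact isRHInfty_one
  · rw [h4]; exact hQ
  · rw [h2]; exact hQ.one_add hQ'
  · rw [one_mul, h3]; exact isRHInfty_one
  · rw [h2]; exact hQ.one_add hQ'
  · rw [h2]; exact hQ.one_add hQ'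

lemma youla_feedback (hQ : IsStrictlyProper Q) : Q / (1 + Q) / (1 - Q / (1 + Q)) = Q := by
  have h := hQ.one_add_ne_zero
  have h1 : 1 - Q / (1 + Q) = 1 / (1 + Q) := by field_simp; ring
  rw [h1]
  field_simp

lemma youla_feedforward (hQ : IsStrictlyProper Q) : 1 / (1 + Q) / (1 - Q / (1 + Q)) = 1 := by
  have h := hQ.one_add_ne_zero
  have h1 : 1 - Q / (1 + Q) = 1 / (1 + Q) := by field_simp; ring
  rw [h1]
  field_simp

open Polynomial in
lemma one_add_freqResp (hQ : IsRHInfty Q) (θ : ℝ) :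
    1 + freqResp Q θ = ((Q.num + Q.denom).map (algebraMap ℝ ℂ)).eval (Complex.exp (θ * Complex.I))
      / (Q.denom.map (algebraMap ℝ ℂ)).eval (Complex.exp (θ * Complex.I)) := by
  have h := hQ.aeval_denom_ne_zero (norm_exp_mul_I θ).ge
  rw [eval_map_algebraMap, eval_map_algebraMap, freqResp, evalAt_eq, map_add, add_div, div_self h,
    add_comm]

open Polynomial in
lemma IsStrictlyProper.num_add_denom_ne_zero (hQ : IsStrictlyProper Q) :
    (Q.num + Q.denom).map (algebraMap ℝ ℂ) ≠ 0 := by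
  rw [Polynomial.map_ne_zero_iff (algebraMap ℝ ℂ).injective]
  intro h
  rw [add_eq_zero_iff_eq_neg] at h
  rw [IsStrictlyProper, h, degree_neg] at hQ
  exact lt_irrefl _ hQ

lemma ae_one_add_freqResp_ne_zero (hQ : IsRHInfty Q) (hQ' : IsStrictlyProper Q) :
    ∀ᵐ θ ∂(volume.restrict (Set.Ioc (-Real.pi) Real.pi)), 1 + freqResp Q θ ≠ 0 := by
  filter_upwards [ae_eval_circle_ne_zero hQ'.num_add_denom_ne_zero] with θ hθ
  rw [one_add_freqResp hQ]
  refine div_ne_zero hθ ?_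
  rw [Polynomial.eval_map_algebraMap]
  exact hQ.aeval_denom_ne_zero (norm_exp_mul_I θ).ge

/-- Although 1 + Q may vanish on the circle, it is a ratio of polynomials, whose log-moduli are
integrable there. -/
lemma intervalIntegrable_log_one_add_freqResp (hQ : IsRHInfty Q) (hQ' : IsStrictlyProper Q) :
    IntervalIntegrable (fun θ => Real.log ‖1 + freqResp Q θ‖) volume (-Real.pi) Real.pi := by
  have h := (intervalIntegrable_log_norm_circle ((Q.num + Q.denom).map (algebraMap ℝ ℂ))).sub
    (intervalIntegrable_log_norm_circle (Q.denom.map (algebraMap ℝ ℂ)))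
  refine h.congr_ae ?_
  rw [Set.uIoc_of_le (by linarith [Real.pi_pos])]
  filter_upwards [ae_eval_circle_ne_zero hQ'.num_add_denom_ne_zero] with θ hθ
  have h2 := hQ.aeval_denom_ne_zero (norm_exp_mul_I θ).ge
  rw [← Polynomial.eval_map_algebraMap] at h2
  rw [one_add_freqResp hQ, norm_div, Real.log_div (norm_ne_zero_iff.2 hθ) (norm_ne_zero_iff.2 h2)]

end TransferFunctions

/-! ### Output spectral density and the objective as a ratio of geometric means -/

section Densities

variable {H Q Qv : RatFunc ℝ} {Sv : ℝ → ℝ}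

lemma IsRHInfty.continuous_noisePSD (hH : IsRHInfty H) : Continuous (noisePSD H) :=
  hH.continuous_freqResp.norm.pow 2

lemma IsRHInfty.isRegularPSD_noisePSD (hH : IsRHInfty H) (hSw : ∀ θ, 0 < noisePSD H θ) :
    IsRegularPSD (noisePSD H) where
  nonneg θ _ := (hSw θ).le
  even θ _ := by rw [noisePSD, noisePSD, norm_freqResp_neg]
  integrable := hH.continuous_noisePSD.intervalIntegrable _ _
  pos := ae_of_all _ hSw
  log_integrable := (hH.continuous_noisePSD.log fun θ => (hSw θ).ne').intervalIntegrable _ _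

lemma IsRHInfty.isPSD_mul (hQv : IsRHInfty Qv) (hSv : IsPSD Sv) :
    IsPSD fun θ => ‖freqResp Qv θ‖ ^ 2 * Sv θ where
  nonneg θ hθ := mul_nonneg (by positivity) (hSv.nonneg θ hθ)
  even θ hθ := by rw [norm_freqResp_neg, hSv.even θ hθ]
  integrable := integrable_mul_continuous hSv.integrable (hQv.continuous_freqResp.norm.pow 2)

/-- The spectral density of the channel output. -/
noncomputable def outputPSD (H : RatFunc ℝ) (Sv : ℝ → ℝ) (Q : RatFunc ℝ) (θ : ℝ) : ℝ :=
  ‖1 + freqResp Q θ‖ ^ 2 * noisePSD H θ + Sv θ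

/-- The logarithm is squeezed: S_y ≥ |1+Q|² S_w, whose logarithm is integrable, and log S_y ≤ S_y -
1. -/
lemma isRegularPSD_outputPSD (hH : IsRHInfty H) (hSw : ∀ θ, 0 < noisePSD H θ) (hQ : IsRHInfty Q)
    (hQ' : IsStrictlyProper Q) (hSv : IsPSD Sv) : IsRegularPSD (outputPSD H Sv Q) := by
  have hle : -Real.pi ≤ Real.pi := by linarith [Real.pi_pos]
  have hcont : Continuous fun θ => ‖1 + freqResp Q θ‖ ^ 2 * noisePSD H θ :=
    ((continuous_const.add hQ.continuous_freqResp).norm.pow 2).mul hH.continuous_noisePSD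
  have hint : IntervalIntegrable (outputPSD H Sv Q) volume (-Real.pi) Real.pi :=
    (hcont.intervalIntegrable _ _).add hSv.integrable
  have hmem : ∀ᵐ θ ∂(volume.restrict (Set.Ioc (-Real.pi) Real.pi)),
      θ ∈ Set.Icc (-Real.pi) Real.pi :=
    (ae_restrict_mem measurableSet_Ioc).mono fun θ hθ => Set.Ioc_subset_Icc_self hθ
  have hpos : ∀ᵐ θ ∂(volume.restrict (Set.Ioc (-Real.pi) Real.pi)),
      0 < ‖1 + freqResp Q θ‖ ^ 2 * noisePSD H θ ∧
      ‖1 + freqResp Q θ‖ ^ 2 * noisePSD H θ ≤ outputPSD H Sv Q θ := by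
    filter_upwards [ae_one_add_freqResp_ne_zero hQ hQ', hmem] with θ h1 h2
    have := hSw θ
    exact ⟨by positivity, le_add_of_nonneg_right (hSv.nonneg θ h2)⟩
  have hlog : IntervalIntegrable (fun θ => Real.log (‖1 + freqResp Q θ‖ ^ 2 * noisePSD H θ)) volume
      (-Real.pi) Real.pi := by
    refine (((intervalIntegrable_log_one_add_freqResp hQ hQ').const_mul 2).add
      (hH.isRegularPSD_noisePSD hSw).log_integrable).congr_ae ?_
    rw [Set.uIoc_of_le hle]
    filter_upwards [ae_one_add_freqResp_ne_zero hQ hQ'] with θ h1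
    rw [Real.log_mul (by positivity) (hSw θ).ne', Real.log_pow]
    simp
  refine ⟨⟨fun θ hθ => ?_, fun θ hθ => ?_, hint⟩, hpos.mono fun θ h => h.1.trans_le h.2, ?_⟩
  · exact add_nonneg (mul_nonneg (by positivity) (hSw θ).le) (hSv.nonneg θ hθ)
  · have h : 1 + freqResp Q (-θ) = (starRingEnd ℂ) (1 + freqResp Q θ) := by
      rw [freqResp_neg, map_add, map_one]
    rw [outputPSD, outputPSD, h, RCLike.norm_conj, hSv.even θ hθ, noisePSD, noisePSD,
      norm_freqResp_neg]
  · rw [intervalIntegrable_iff_integrableOn_Ioc_of_le hle] at hint hlog ⊢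
    refine Integrable.mono' (hint.add hlog.abs)
      (Real.measurable_log.comp_aemeasurable hint.1.aemeasurable).aestronglyMeasurable ?_
    filter_upwards [hpos] with θ h
    have h1 := Real.log_le_sub_one_of_pos (h.1.trans_le h.2)
    have h2 := Real.log_le_log h.1 h.2
    have h3 := neg_abs_le (Real.log (‖1 + freqResp Q θ‖ ^ 2 * noisePSD H θ))
    have h4 := abs_nonneg (Real.log (‖1 + freqResp Q θ‖ ^ 2 * noisePSD H θ))
    have h5 := h.1.trans_le h.2
    rw [Real.norm_eq_abs, abs_le]
    simp only [Pi.add_apply]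
    constructor <;> linarith

/-- The integrand of the objective, in terms of spectral densities. -/
lemma logb_objective_ae (hH : IsRHInfty H) (hSw : ∀ θ, 0 < noisePSD H θ) (hQ : IsRHInfty Q)
    (hQ' : IsStrictlyProper Q) (hSv : IsPSD Sv) :
    (fun θ => 1 / 2 * Real.logb 2 (Sv θ / noisePSD H θ + ‖1 + freqResp Q θ‖ ^ 2))
      =ᵐ[volume.restrict (Set.Ioc (-Real.pi) Real.pi)] fun θ =>
        (1 / (2 * Real.log 2)) * (Real.log (outputPSD H Sv Q θ) - Real.log (noisePSD H θ)) := by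
  filter_upwards [(isRegularPSD_outputPSD hH hSw hQ hQ' hSv).pos] with θ h
  have h1 : Sv θ / noisePSD H θ + ‖1 + freqResp Q θ‖ ^ 2 = outputPSD H Sv Q θ / noisePSD H θ := by
    have := (hSw θ).ne'
    rw [outputPSD]
    field_simp
    ring
  rw [h1, Real.logb, Real.log_div h.ne' (hSw θ).ne']
  field_simp

/-- The integrand is a multiple of log S_y - log S_w off a null set, and each integral is the
logarithm of a geometric mean. -/
lemma objective_eq (hH : IsRHInfty H) (hSw : ∀ θ, 0 < noisePSD H θ) (hQ : IsRHInfty Q)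
    (hQ' : IsStrictlyProper Q) (hSv : IsPSD Sv) :
    objective H Sv Q
      = 1 / 2 * Real.logb 2 (geomMean (outputPSD H Sv Q) / geomMean (noisePSD H)) := by
  have hle : -Real.pi ≤ Real.pi := by linarith [Real.pi_pos]
  rw [objective, intervalIntegral.integral_of_le hle,
    integral_congr_ae (logb_objective_ae hH hSw hQ hQ' hSv), ← intervalIntegral.integral_of_le hle,
    intervalIntegral.integral_const_mul, intervalIntegral.integral_sub
      (isRegularPSD_outputPSD hH hSw hQ hQ' hSv).log_integrable
      (hH.isRegularPSD_noisePSD hSw).log_integrable, geomMean, geomMean, ← Real.exp_sub,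
    Real.logb, Real.log_exp]
  field_simp

end Densities

/-! ### Signals as sequences in L² -/

section Signals

variable {Ω : Type*} [MeasurableSpace Ω] {μ : Measure Ω}

/-- The elements of `L²` given by a family of random variables. -/
noncomputable def lpSeq {T : Type*} {X : T → Ω → ℝ} (hX : ∀ t, MemLp (X t) 2 μ) (t : T) :
    Lp ℝ 2 μ := (hX t).toLp (X t)

variable {G : RatFunc ℝ} {X Y : ℤ → Ω → ℝ}

lemma memLp_filter (hX : ∀ t, MemLp (X t) 2 μ) (g : ℕ → ℝ) (N : ℕ) (t : ℤ) :
    MemLp (fun ω => ∑ k ∈ Finset.range N, g k * X (t - k) ω) 2 μ :=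
  memLp_finsetSum _ fun k _ => (hX (t - k)).const_mul (g k)

/-- Square integrability is not part of `IsOutput`, but the L² distance to some partial sum is
finite because these distances tend to 0. -/
lemma IsOutput.memLp (h : IsOutput G X Y μ) (hX : ∀ t, MemLp (X t) 2 μ) (t : ℤ) :
    MemLp (Y t) 2 μ := by
  obtain ⟨hY, g, -, hg⟩ := h
  obtain ⟨N, hN⟩ := ((hg t).eventually_lt_const (ENNReal.zero_lt_top)).exists
  have h1 : MemLp (fun ω => Y t ω - ∑ k ∈ Finset.range N, g k * X (t - k) ω) 2 μ :=
    ⟨(hY t).aestronglyMeasurable.sub (memLp_filter hX g N t).1, hN⟩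
  have h2 := h1.add (memLp_filter hX g N t)
  exact h2.ae_eq (ae_of_all _ fun ω => by simp)

lemma tendsto_toLp {f : ℕ → Lp ℝ 2 μ} {F : ℕ → Ω → ℝ} (hF : ∀ n, ⇑(f n) =ᵐ[μ] F n) {Y : Ω → ℝ}
    (hY : MemLp Y 2 μ) :
    Tendsto f atTop (𝓝 (hY.toLp Y)) ↔
      Tendsto (fun n => eLpNorm (fun ω => Y ω - F n ω) 2 μ) atTop (𝓝 0) := by
  rw [Lp.tendsto_Lp_iff_tendsto_eLpNorm']
  refine tendsto_congr fun n => ?_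
  rw [eLpNorm_sub_comm]
  refine eLpNorm_congr_ae ?_
  filter_upwards [hF n, hY.coeFn_toLp] with ω h1 h2
  rw [Pi.sub_apply, h1, h2]

lemma IsOutput.exists_tendsto (h : IsOutput G X Y μ) (hX : ∀ t, MemLp (X t) 2 μ)
    (hY : ∀ t, MemLp (Y t) 2 μ) :
    ∃ g : ℕ → ℝ, IsImpulseResponse G g ∧ ∀ t : ℤ,
      Tendsto (fun N => ∑ k ∈ Finset.range N, g k • lpSeq hX (t - k)) atTop (𝓝 (lpSeq hY t)) := by
  obtain ⟨-, g, hg, hlim⟩ := h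
  exact ⟨g, hg, fun t => (tendsto_toLp (fun N => toLp_sum_smul (fun k : ℕ => hX (t - k)) _ g)
    (hY t)).2 (hlim t)⟩

lemma HasSpectrum.of_isImpulseResponse {E : Type*} [NormedAddCommGroup E] [InnerProductSpace ℝ E]
    {S : ℝ → ℝ} {x y : ℤ → E} (hx : HasSpectrum S x)
    (hS : IntervalIntegrable S volume (-Real.pi) Real.pi) {g : ℕ → ℝ} (hg : IsImpulseResponse G g)
    (hy : ∀ t : ℤ, Tendsto (fun N => ∑ k ∈ Finset.range N, g k • x (t - k)) atTop (𝓝 (y t))) :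
    HasSpectrum (fun θ => ‖freqResp G θ‖ ^ 2 * S θ) y := by
  refine hx.of_tendsto hS hg.summable (fun θ => ?_) hy
  rw [← norm_freqResp_neg]
  exact (hg.tendsto_trigSum θ).norm

/-- The spectral density of `x + y`, where `y` is the output of `G` driven by `x`. -/
lemma HasSpectrum.of_isImpulseResponse_add {E : Type*} [NormedAddCommGroup E]
    [InnerProductSpace ℝ E]
    {S : ℝ → ℝ} {x y : ℤ → E} (hx : HasSpectrum S x)
    (hS : IntervalIntegrable S volume (-Real.pi) Real.pi) {g : ℕ → ℝ} (hg : IsImpulseResponse G g)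
    (hy : ∀ t : ℤ, Tendsto (fun N => ∑ k ∈ Finset.range N, g k • x (t - k)) atTop (𝓝 (y t))) :
    HasSpectrum (fun θ => ‖1 + freqResp G θ‖ ^ 2 * S θ) (fun t => x t + y t) := by
  -- The sum δ + g is the impulse response of 1 + G.
  set δ : ℕ → ℝ := fun k => if k = 0 then 1 else 0 with hδ
  have hsum : Summable fun k => |δ k + g k| := by
    have h1 : Summable δ := summable_of_ne_finset_zero (s := {0}) fun k hk => by
      simp only [Finset.mem_singleton] at hk
      simp [hδ, hk]
    exact (h1.add (summable_abs_iff.1 hg.summable)).abs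
  refine hx.of_tendsto (g := fun k => δ k + g k) hS hsum (fun θ => ?_) fun t => ?_
  · have h1 : ‖1 + freqResp G θ‖ = ‖1 + freqResp G (-θ)‖ := by
      rw [freqResp_neg, ← RCLike.norm_conj, map_add, map_one]
    rw [h1]
    refine Tendsto.norm ((hg.tendsto_trigSum θ).const_add 1 |>.congr' ?_)
    filter_upwards [eventually_gt_atTop 0] with N hN
    simp only [trigSum]
    push_cast
    simp_rw [add_mul, Finset.sum_add_distrib]
    congr 1
    symm
    rw [Finset.sum_eq_single 0]
    · simp [hδ]
    · intro k _ hk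
      simp [hδ, hk]
    · intro h
      exact absurd (Finset.mem_range.2 hN) h
  · refine ((hy t).const_add (x t)).congr' ?_
    filter_upwards [eventually_gt_atTop 0] with N hN
    simp_rw [add_smul, Finset.sum_add_distrib]
    congr 1
    simp [hδ, hN]

lemma IsOutput.mem_closure (h : IsOutput G X Y μ) (hX : ∀ t, MemLp (X t) 2 μ)
    (hY : ∀ t, MemLp (Y t) 2 μ) (t : ℤ) :
    lpSeq hY t ∈ (Submodule.span ℝ (Set.range (lpSeq hX))).topologicalClosure := by
  obtain ⟨g, -, hg⟩ := h.exists_tendsto hX hY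
  refine mem_closure_of_tendsto (hg t) (Eventually.of_forall fun N => ?_)
  exact Submodule.sum_mem _ fun k _ => Submodule.smul_mem _ _
    (Submodule.subset_span (Set.mem_range_self _))

/-- Strict properness kills the term k = 0, the only one outside the past. -/
lemma IsOutput.mem_past (h : IsOutput G X Y μ) (hG : IsStrictlyProper G)
    (hX : ∀ t, MemLp (X t) 2 μ) (hY : ∀ t, MemLp (Y t) 2 μ) (t : ℤ) :
    lpSeq hY t ∈ past (lpSeq hX) t := by
  obtain ⟨g, hg, hlim⟩ := h.exists_tendsto hX hY
  refine (Submodule.isClosed_topologicalClosure _).mem_of_tendsto (hlim t)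
    (Eventually.of_forall fun N => ?_)
  refine Submodule.sum_mem _ fun k _ => ?_
  rcases k with _ | k
  · rw [hg.zero_of_isStrictlyProper hG, zero_smul]
    exact Submodule.zero_mem _
  · exact Submodule.smul_mem _ _ (FeedbackCapacity.mem_past (by push_cast; omega))

variable {Z V W : ℤ → Ω → ℝ}

lemma IsWhiteGaussian.memLp (hZ : IsWhiteGaussian Z μ) (t : ℤ) : MemLp (Z t) 2 μ := by
  have h := memLp_id_gaussianReal (μ := 0) (v := 1) 2
  rw [← hZ.law t] at h
  exact h.comp_of_map (hZ.measurable t).aemeasurable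

lemma IsWhiteGaussian.mean (hZ : IsWhiteGaussian Z μ) (t : ℤ) : ∫ ω, Z t ω ∂μ = 0 := by
  rw [← integral_map (f := fun x : ℝ => x) (hZ.measurable t).aemeasurable (by fun_prop), hZ.law]
  exact integral_id_gaussianReal

lemma IsWhiteGaussian.isGaussianProcess (hZ : IsWhiteGaussian Z μ) : IsGaussianProcess Z μ := by
  refine ⟨fun I => ?_⟩
  exact iIndepFun.hasGaussianLaw (X := fun t : I => Z t)
    (fun t => ⟨by rw [hZ.law]; infer_instance⟩) (hZ.indep.precomp Subtype.val_injective)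

lemma integral_cos_int {n : ℤ} (hn : n ≠ 0) :
    ∫ θ in (-Real.pi)..Real.pi, Real.cos (n * θ) = 0 := by
  rw [intervalIntegral.integral_comp_mul_left (fun x => Real.cos x) (by exact_mod_cast hn),
    integral_cos, Real.sin_int_mul_pi, mul_neg, Real.sin_neg, Real.sin_int_mul_pi]
  simp

lemma IsWhiteGaussian.hasSpectrum (hZ : IsWhiteGaussian Z μ) :
    HasSpectrum (fun _ => 1) (lpSeq hZ.memLp) := by
  intro s t
  rw [lpSeq, lpSeq, inner_toLp]
  simp only [one_mul]
  by_cases hst : s = t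
  · subst hst
    have h : ∫ ω, Z s ω * Z s ω ∂μ = 1 := by
      rw [← integral_map (f := fun x : ℝ => x * x) (hZ.measurable s).aemeasurable (by fun_prop),
        hZ.law]
      have := variance_fun_id_gaussianReal (μ := 0) (v := 1)
      rw [variance_of_integral_eq_zero (by fun_prop) (by simp)] at this
      simpa [sq] using this
    rw [h]
    simp
    have := Real.pi_ne_zero
    field_simp
    norm_num
  · have h := integral_cos_int (sub_ne_zero.2 (Ne.symm hst))
    push_cast at h
    rw [h, (hZ.indep.indepFun hst).integral_fun_mul_eq_mul_integral
      (hZ.measurable s).aestronglyMeasurable (hZ.measurable t).aestronglyMeasurable, hZ.mean]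
    simp

lemma IsStationaryGaussian.memLp {S : ℝ → ℝ} (hV : IsStationaryGaussian S V μ) (t : ℤ) :
    MemLp (V t) 2 μ := (hV.gaussian.hasGaussianLaw_eval t).memLp_two

lemma IsStationaryGaussian.hasSpectrum {S : ℝ → ℝ} (hV : IsStationaryGaussian S V μ) :
    HasSpectrum S (lpSeq hV.memLp) := by
  intro s t
  rw [lpSeq, lpSeq, inner_toLp, hV.cov]

/-- The average power of a stationary process. -/
lemma hasAveragePower_of_hasSpectrum {U : ℤ → Ω → ℝ} (hUL : ∀ t, MemLp (U t) 2 μ) {S : ℝ → ℝ}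
    (hS : HasSpectrum S (lpSeq hUL)) :
    HasAveragePower U μ ((1 / (2 * Real.pi)) * ∫ θ in (-Real.pi)..Real.pi, S θ) := by
  refine ⟨hUL, ?_⟩
  have h : ∀ t, ∫ ω, U t ω ^ 2 ∂μ = (1 / (2 * Real.pi)) * ∫ θ in (-Real.pi)..Real.pi, S θ := by
    intro t
    have := hS t t
    rw [lpSeq, inner_toLp] at this
    simp_rw [sq, this]
    simp
  refine tendsto_const_nhds.congr' ?_
  filter_upwards [eventually_gt_atTop 0] with T hT
  simp_rw [h]
  rw [Finset.sum_const, Finset.card_range, nsmul_eq_mul, mul_div_cancel_left₀]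
  exact_mod_cast hT.ne'

end Signals

/-! ### Directed information rate and power of the closed loop -/

section Rate

variable {Ω : Type*} [MeasurableSpace Ω] {μ : Measure Ω} [IsProbabilityMeasure μ]
  {U Y : ℤ → Ω → ℝ}

/-- One term of the directed information between jointly Gaussian processes. -/
lemma condMutualInfo_block (hUm : ∀ t, Measurable (U t)) (hYm : ∀ t, Measurable (Y t))
    (hUL : ∀ t, MemLp (U t) 2 μ) (hYL : ∀ t, MemLp (Y t) 2 μ) {E : Submodule ℝ (Lp ℝ 2 μ)}
    (hE : ∀ f ∈ E, IsCentredGaussian f) (hUE : ∀ t, lpSeq hUL t ∈ E) (hYE : ∀ t, lpSeq hYL t ∈ E)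
    (n : ℕ) {r s : ℝ} (hr0 : 0 < r) (hs0 : 0 < s)
    (hr : Metric.infDist (lpSeq hYL (n + 1)) (Submodule.span ℝ
      (Set.range fun i : Fin n => lpSeq hYL (i + 1))) ^ 2 = r)
    (hs : Metric.infDist (lpSeq hYL (n + 1)) (Submodule.span ℝ
      (Set.range (Sum.elim (fun i : Fin n => lpSeq hYL (i + 1))
        (fun i : Fin (n + 1) => lpSeq hUL (i + 1))))) ^ 2 = s) :
    condMutualInfo (block U (n + 1)) (Y ((n : ℤ) + 1)) (block Y n) μ
      = ENNReal.ofReal (1 / 2 * Real.logb 2 (r / s)) := by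
  obtain ⟨M, hM, hind, hlaw⟩ := exists_regression (X := fun i : Fin n => Y ((i : ℤ) + 1))
    (fun i => hYL _) (hYL (n + 1)) hE (fun i => hYE _) (hYE _)
  -- Past outputs and inputs form one family of regressors; the input block includes the current
  -- time n + 1.
  set X' : Fin n ⊕ Fin (n + 1) → Ω → ℝ :=
    Sum.elim (fun i : Fin n => Y ((i : ℤ) + 1)) (fun i : Fin (n + 1) => U ((i : ℤ) + 1)) with hX'
  have hX'L : ∀ i, MemLp (X' i) 2 μ := by
    rintro (i | i)
    · exact hYL _
    · exact hUL _
  obtain ⟨M', hM', hind', hlaw'⟩ := exists_regression (X := X') hX'L (hYL (n + 1)) hE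
    (by rintro (i | i); exacts [hYE _, hUE _]) (hYE _)
  have hX'lp : (fun i => (hX'L i).toLp (X' i)) = Sum.elim (fun i : Fin n => lpSeq hYL (i + 1))
        (fun i : Fin (n + 1) => lpSeq hUL (i + 1)) := by
    funext i
    rcases i with i | i <;> rfl
  rw [hX'lp] at hlaw'
  have hX'e : ∀ ω, (fun i => X' i ω) = Sum.elim (block Y n ω) (block U (n + 1) ω) := by
    intro ω
    funext i
    rcases i with i | i <;> rfl
  simp_rw [hX'e] at hind' hlaw'
  have hr' : Metric.infDist ((hYL (n + 1)).toLp (Y (n + 1))) (Submodule.span ℝ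
      (Set.range fun i : Fin n => (hYL (i + 1)).toLp (Y (i + 1)))) ^ 2 = r := hr
  have hs' : Metric.infDist ((hYL (n + 1)).toLp (Y (n + 1))) (Submodule.span ℝ
      (Set.range (Sum.elim (fun i : Fin n => lpSeq hYL (i + 1))
        (fun i : Fin (n + 1) => lpSeq hUL (i + 1))))) ^ 2 = s := hs
  rw [hr'] at hlaw
  rw [hs'] at hlaw'
  have hblock : ∀ (X : ℤ → Ω → ℝ) (m : ℕ), (∀ t, Measurable (X t)) → Measurable (block X m) :=
    fun X m h => measurable_pi_lambda _ fun i => h _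
  have hMm : Measurable fun p : (Fin n → ℝ) × (Fin (n + 1) → ℝ) => M' (Sum.elim p.1 p.2) := by
    refine hM'.comp (measurable_pi_lambda _ ?_)
    rintro (i | i)
    · simp only [Sum.elim_inl]; fun_prop
    · simp only [Sum.elim_inr]; fun_prop
  have h := condMutualInfo_regression (Z := block Y n) (X := block U (n + 1)) (M := M)
    (M' := fun p => M' (Sum.elim p.1 p.2))
    (Real.toNNReal_pos.2 hr0).ne' (Real.toNNReal_pos.2 hs0).ne' (hblock Y n hYm)
    (hblock U (n + 1) hUm) (hYm (n + 1)) hM hMm hind hlaw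
    (hind'.comp (φ := fun g => (fun i => g (Sum.inl i), fun j => g (Sum.inr j))) (ψ := id)
      (by fun_prop) measurable_id) hlaw'
  rwa [Real.coe_toNNReal _ hr0.le, Real.coe_toNNReal _ hs0.le] at h

/-- The directed information rate of jointly Gaussian processes is given by the limits of the
prediction errors. -/
lemma hasDirectedInfoRate_of_tendsto (hUm : ∀ t, Measurable (U t)) (hYm : ∀ t, Measurable (Y t))
    (hUL : ∀ t, MemLp (U t) 2 μ) (hYL : ∀ t, MemLp (Y t) 2 μ) {E : Submodule ℝ (Lp ℝ 2 μ)}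
    (hE : ∀ f ∈ E, IsCentredGaussian f) (hUE : ∀ t, lpSeq hUL t ∈ E) (hYE : ∀ t, lpSeq hYL t ∈ E)
    {r s : ℕ → ℝ} {r₀ s₀ : ℝ} (hr0 : 0 < r₀) (hs0 : 0 < s₀)
    (hr : ∀ n : ℕ, Metric.infDist (lpSeq hYL ((n : ℤ) + 1)) (Submodule.span ℝ
      (Set.range fun i : Fin n => lpSeq hYL (i + 1)) : Set (Lp ℝ 2 μ)) ^ 2 = r n)
    (hs : ∀ n : ℕ, Metric.infDist (lpSeq hYL ((n : ℤ) + 1)) (Submodule.span ℝ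
      (Set.range (Sum.elim (fun i : Fin n => lpSeq hYL (i + 1))
        (fun i : Fin (n + 1) => lpSeq hUL (i + 1)))) : Set (Lp ℝ 2 μ)) ^ 2 = s n)
    (hrl : ∀ n, r₀ ≤ r n) (hsl : ∀ n, s₀ ≤ s n)
    (hrt : Tendsto r atTop (𝓝 r₀)) (hst : Tendsto s atTop (𝓝 s₀)) :
    HasDirectedInfoRate U Y μ (1 / 2 * Real.logb 2 (r₀ / s₀)) := by
  have hterm : ∀ n : ℕ, condMutualInfo (block U (n + 1)) (Y ((n : ℤ) + 1)) (block Y n) μ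
      = ENNReal.ofReal (1 / 2 * Real.logb 2 (r n / s n)) := fun n =>
    condMutualInfo_block hUm hYm hUL hYL hE hUE hYE n (hr0.trans_le (hrl n)) (hs0.trans_le (hsl n))
      (hr n) (hs n)
  -- More regressors can only decrease the distance; nonnegativity lets `ENNReal.ofReal` commute
  -- with the sum.
  have hnn : ∀ n, 0 ≤ 1 / 2 * Real.logb 2 (r n / s n) := by
    intro n
    have hsn := hs0.trans_le (hsl n)
    refine mul_nonneg (by norm_num) (Real.logb_nonneg (by norm_num) ((one_le_div hsn).2 ?_))
    rw [← hr n, ← hs n]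
    refine pow_le_pow_left₀ Metric.infDist_nonneg (Metric.infDist_le_infDist_of_subset
      (Submodule.span_mono ?_) ⟨0, Submodule.zero_mem _⟩) 2
    rintro _ ⟨i, rfl⟩
    exact ⟨Sum.inl i, rfl⟩
  have hlim : Tendsto (fun n => 1 / 2 * Real.logb 2 (r n / s n)) atTop
      (𝓝 (1 / 2 * Real.logb 2 (r₀ / s₀))) := by
    simp_rw [Real.logb]
    exact ((((hrt.div hst hs0.ne').log (div_pos hr0 hs0).ne')).div_const _).const_mul _
  have hdi : ∀ T, directedInfo U Y μ T
      = ENNReal.ofReal (∑ n ∈ Finset.range T, 1 / 2 * Real.logb 2 (r n / s n)) := by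
    intro T
    rw [directedInfo, ENNReal.ofReal_sum_of_nonneg fun n _ => hnn n]
    exact Finset.sum_congr rfl fun n _ => hterm n
  refine ⟨fun T => by rw [hdi]; exact ENNReal.ofReal_ne_top, ?_⟩
  refine hlim.cesaro.congr fun T => ?_
  rw [hdi, ENNReal.toReal_ofReal (Finset.sum_nonneg fun n _ => hnn n)]
  exact (div_eq_inv_mul _ _).symm

variable {H Kv K : RatFunc ℝ} {Sv : ℝ → ℝ} {W V : ℤ → Ω → ℝ}

/-- The directed information rate and the average input power of the closed loop. -/
theorem IsClosedLoop.hasRate (hH : IsRHInfty H) (hSw : ∀ θ, 0 < noisePSD H θ)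
    (hK : IsStabilizing 1 Kv K) (hK' : IsStrictlyProper K) (hSv : IsPSD Sv)
    (h : IsClosedLoop H Kv K Sv W V U Y μ) :
    HasDirectedInfoRate U Y μ
      (objective H (fun θ => ‖freqResp (Kv / (1 - K)) θ‖ ^ 2 * Sv θ) (K / (1 - K))) ∧
    HasAveragePower U μ
      (inputPower H (fun θ => ‖freqResp (Kv / (1 - K)) θ‖ ^ 2 * Sv θ) (K / (1 - K))) := by
  have hQ : IsRHInfty (K / (1 - K)) := by simpa using hK.w_to_u
  have hQv : IsRHInfty (Kv / (1 - K)) := by simpa using hK.v_to_u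
  have hQ' : IsStrictlyProper (K / (1 - K)) := hK'.div_one_sub
  have hSv' := hQv.isPSD_mul hSv
  have hregw := hH.isRegularPSD_noisePSD hSw
  have hregy := isRegularPSD_outputPSD hH hSw hQ hQ' hSv'
  obtain ⟨Z, hZ, hHW⟩ := h.noise
  obtain ⟨A, B, hA, hB, hU⟩ := h.input
  have hZL := hZ.memLp
  have hWL := hHW.memLp hZL
  have hVL := h.exogenous.memLp
  have hAL := hA.memLp hWL
  have hBL := hB.memLp hVL
  have hUL : ∀ t, MemLp (U t) 2 μ := fun t => ((hAL t).add (hBL t)).ae_eq (hU t).symm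
  have hYL : ∀ t, MemLp (Y t) 2 μ := fun t => ((hUL t).add (hWL t)).ae_eq (h.channel t).symm
  have hu : ∀ t, lpSeq hUL t = lpSeq hAL t + lpSeq hBL t := fun t => by
    rw [lpSeq, lpSeq, lpSeq, ← MemLp.toLp_add]
    exact MemLp.toLp_congr _ _ (hU t)
  have hy : ∀ t, lpSeq hYL t = lpSeq hUL t + lpSeq hWL t := fun t => by
    rw [lpSeq, lpSeq, lpSeq, ← MemLp.toLp_add]
    exact MemLp.toLp_congr _ _ (h.channel t)
  -- joint Gaussianity
  have hE0 := isCentredGaussian_topologicalClosure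
    (isCentredGaussian_of_mem_span hZ.isGaussianProcess hZL hZ.mean)
  have hwE0 := hHW.mem_closure hZL hWL
  have hWG : IsGaussianProcess W μ := isGaussianProcess_of_mem hWL hE0 hwE0
  have hW0 : ∀ t, ∫ ω, W t ω ∂μ = 0 := fun t => by
    rw [← (hE0 _ (hwE0 t)).integral_eq_zero]
    exact integral_congr_ae (hWL t).coeFn_toLp.symm
  -- W and V are independent Gaussian processes, so their joint closed span is a Gaussian space; it
  -- contains U and Y.
  have hE := isCentredGaussian_topologicalClosure (isCentredGaussian_of_mem_sup hWG
    h.exogenous.gaussian hWL hVL hW0 h.exogenous.mean h.indep)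
  set Pw := Submodule.span ℝ (Set.range (lpSeq hWL)) with hPw
  set Pv := Submodule.span ℝ (Set.range (lpSeq hVL)) with hPv
  change ∀ f ∈ (Pw ⊔ Pv).topologicalClosure, _ at hE
  have hcw : Pw.topologicalClosure ≤ (Pw ⊔ Pv).topologicalClosure :=
    Submodule.topologicalClosure_mono le_sup_left
  have hcv : Pv.topologicalClosure ≤ (Pw ⊔ Pv).topologicalClosure :=
    Submodule.topologicalClosure_mono le_sup_right
  have hwP : ∀ t, lpSeq hWL t ∈ Pw.topologicalClosure := fun t =>
    Submodule.le_topologicalClosure _ (Submodule.subset_span (Set.mem_range_self t))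
  have haP := hA.mem_closure hWL hAL
  have hbP := hB.mem_closure hVL hBL
  have huE : ∀ t, lpSeq hUL t ∈ (Pw ⊔ Pv).topologicalClosure := fun t => by
    rw [hu]
    exact Submodule.add_mem _ (hcw (haP t)) (hcv (hbP t))
  have hyE : ∀ t, lpSeq hYL t ∈ (Pw ⊔ Pv).topologicalClosure := fun t => by
    rw [hy]
    exact Submodule.add_mem _ (huE t) (hcw (hwP t))
  -- orthogonality
  have hwv : ∀ s t, inner ℝ (lpSeq hWL s) (lpSeq hVL t) = 0 := by
    intro s t
    rw [lpSeq, lpSeq, inner_toLp]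
    have h1 : IndepFun (W s) (V t) μ :=
      h.indep.comp (φ := fun x : ℤ → ℝ => x s) (ψ := fun x : ℤ → ℝ => x t) (by fun_prop) (by fun_prop)
    rw [h1.integral_fun_mul_eq_mul_integral (hWL s).1 (hVL t).1, hW0, zero_mul]
  have horth : ∀ p ∈ Pw.topologicalClosure, ∀ q ∈ Pv.topologicalClosure, inner ℝ p q = 0 := by
    have h1 : Pw ⟂ Pv := by
      rw [hPw, hPv, Submodule.isOrtho_span]
      rintro _ ⟨s, rfl⟩ _ ⟨t, rfl⟩
      exact hwv s t
    have h2 : Pw.topologicalClosure ⟂ Pv :=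
      Submodule.topologicalClosure_minimal _ h1 (Submodule.isClosed_orthogonal _)
    have h3 : Pv.topologicalClosure ⟂ Pw.topologicalClosure :=
      Submodule.topologicalClosure_minimal _ h2.symm (Submodule.isClosed_orthogonal _)
    exact Submodule.isOrtho_iff_inner_eq.1 h3.symm
  -- spectral densities
  obtain ⟨gw, hgw, hlw⟩ := hHW.exists_tendsto hZL hWL
  obtain ⟨ga, hga, hla⟩ := hA.exists_tendsto hWL hAL
  obtain ⟨gb, hgb, hlb⟩ := hB.exists_tendsto hVL hBL
  have hsw : HasSpectrum (noisePSD H) (lpSeq hWL) := by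
    have := hZ.hasSpectrum.of_isImpulseResponse intervalIntegrable_const hgw hlw
    simp only [mul_one] at this
    exact this
  have hsa := hsw.of_isImpulseResponse hregw.integrable hga hla
  have hswa := hsw.of_isImpulseResponse_add hregw.integrable hga hla
  have hsb := h.exogenous.hasSpectrum.of_isImpulseResponse hSv.integrable hgb hlb
  have hia : IntervalIntegrable (fun θ => ‖freqResp (K / (1 - K)) θ‖ ^ 2 * noisePSD H θ) volume
      (-Real.pi) Real.pi :=
    integrable_mul_continuous hregw.integrable (hQ.continuous_freqResp.norm.pow 2)
  have hiwa : IntervalIntegrable (fun θ => ‖1 + freqResp (K / (1 - K)) θ‖ ^ 2 * noisePSD H θ) volume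
      (-Real.pi) Real.pi :=
    integrable_mul_continuous hregw.integrable
      ((continuous_const.add hQ.continuous_freqResp).norm.pow 2)
  have hsu : HasSpectrum (fun θ => ‖freqResp (K / (1 - K)) θ‖ ^ 2 * noisePSD H θ
      + ‖freqResp (Kv / (1 - K)) θ‖ ^ 2 * Sv θ) (lpSeq hUL) := by
    have := hsa.add hsb hia hSv'.integrable fun s t => horth _ (haP s) _ (hbP t)
    rwa [← funext hu] at this
  have hsy : HasSpectrum (outputPSD H (fun θ => ‖freqResp (Kv / (1 - K)) θ‖ ^ 2 * Sv θ)
      (K / (1 - K))) (lpSeq hYL) := by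
    have := hswa.add hsb hiwa hSv'.integrable fun s t =>
      horth _ (Submodule.add_mem _ (hwP s) (haP s)) _ (hbP t)
    have h1 : (fun t => lpSeq hWL t + lpSeq hAL t + lpSeq hBL t) = lpSeq hYL := by
      funext t
      rw [hy, hu]
      abel
    rwa [h1] at this
  -- The two prediction errors of Y, from its own past and with the inputs added, tend to the
  -- geometric means of the output and noise densities.
  obtain ⟨hr1, hr2⟩ := hsy.tendsto_infDist_sq hregy
  obtain ⟨hs1, hs2⟩ := hsw.tendsto_infDist_sq_feedback hregw hy hu
    (hA.mem_past hQ' hWL hAL) (V := Pv.topologicalClosure) hbP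
    fun t v hv => horth _ (hwP t) v hv
  constructor
  · rw [objective_eq hH hSw hQ hQ' hSv']
    exact hasDirectedInfoRate_of_tendsto h.measurable_U h.measurable_Y hUL hYL hE huE hyE
      (Real.exp_pos _) (Real.exp_pos _) (fun _ => rfl) (fun _ => rfl) hr1 hs1 hr2 hs2
  · have := hasAveragePower_of_hasSpectrum hUL hsu
    rw [inputPower]
    simpa only [add_comm] using this

end Rate

/-! ### Construction of Gaussian processes and of the closed loop -/

section Existence

/-- The isonormal Gaussian process over a Hilbert space. -/
theorem exists_gaussian_isometry (F : Type) [NormedAddCommGroup F] [InnerProductSpace ℝ F]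
    [CompleteSpace F] :
    ∃ (Ω : Type) (_ : MeasurableSpace Ω) (μ : Measure Ω) (_ : IsProbabilityMeasure μ)
      (Φ : F →ₗᵢ[ℝ] Lp ℝ 2 μ), ∀ x, IsCentredGaussian (Φ x) := by
  obtain ⟨w, b, -⟩ := exists_hilbertBasis ℝ F
  -- One independent standard Gaussian per vector of a Hilbert basis; the isometry sends basis
  -- vectors to coordinates.
  let μ : Measure (w → ℝ) := Measure.infinitePi fun _ => gaussianReal 0 1
  have hlaw : ∀ i : w, μ.map (fun ω => ω i) = gaussianReal 0 1 := fun i =>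
    Measure.infinitePi_map_eval _ i
  have hind : iIndepFun (fun (i : w) (ω : w → ℝ) => ω i) μ :=
    iIndepFun_infinitePi (X := fun _ x => x) fun _ => measurable_id
  have hL : ∀ i : w, MemLp (fun ω : w → ℝ => ω i) 2 μ := fun i => by
    have h := memLp_id_gaussianReal (μ := 0) (v := 1) 2
    rw [← hlaw i] at h
    exact h.comp_of_map (measurable_pi_apply i).aemeasurable
  have h0 : ∀ i : w, ∫ ω : w → ℝ, ω i ∂μ = 0 := fun i => by
    rw [← integral_map (φ := fun ω : w → ℝ => ω i) (f := fun x : ℝ => x)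
      (measurable_pi_apply i).aemeasurable aestronglyMeasurable_id, hlaw]
    exact integral_id_gaussianReal
  have hG : IsGaussianProcess (fun (i : w) (ω : w → ℝ) => ω i) μ :=
    ⟨fun I => iIndepFun.hasGaussianLaw (X := fun (i : I) (ω : w → ℝ) => ω i)
      (fun i => ⟨by rw [hlaw]; infer_instance⟩) (hind.precomp Subtype.val_injective)⟩
  have horth : Orthonormal ℝ (lpSeq hL) := by
    refine ⟨fun i => ?_, fun i j hij => ?_⟩
    · have h : ∫ ω : w → ℝ, ω i * ω i ∂μ = 1 := by
        rw [← integral_map (φ := fun ω : w → ℝ => ω i) (f := fun x : ℝ => x * x)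
          (measurable_pi_apply i).aemeasurable (by fun_prop), hlaw]
        have := variance_fun_id_gaussianReal (μ := 0) (v := 1)
        rw [variance_of_integral_eq_zero (by fun_prop) (by simp)] at this
        simpa [sq] using this
      rw [← inner_toLp (hL i) (hL i)] at h
      rw [← sq_eq_sq₀ (norm_nonneg _) zero_le_one, ← real_inner_self_eq_norm_sq, one_pow]
      exact h
    · refine (inner_toLp (hL i) (hL j)).trans ?_
      rw [(hind.indepFun hij).integral_fun_mul_eq_mul_integral (hL i).1 (hL j).1, h0, zero_mul]
  have hCG := isCentredGaussian_topologicalClosure (isCentredGaussian_of_mem_span hG hL h0)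
  refine ⟨w → ℝ, inferInstance, μ, inferInstance,
    horth.orthogonalFamily.linearIsometry.comp b.repr.toLinearIsometry, fun x => hCG _ ?_⟩
  have hmem : horth.orthogonalFamily.linearIsometry (b.repr x)
      ∈ LinearMap.range horth.orthogonalFamily.linearIsometry.toLinearMap := ⟨_, rfl⟩
  rw [OrthogonalFamily.range_linearIsometry] at hmem
  refine Submodule.topologicalClosure_mono (iSup_le fun i => ?_) hmem
  rintro _ ⟨c, rfl⟩
  exact Submodule.smul_mem _ c (Submodule.subset_span ⟨i, rfl⟩)

/-- Vectors of a Hilbert space with a given spectral density. -/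
lemma IsPSD.exists_hasSpectrum {S : ℝ → ℝ} (hS : IsPSD S) :
    ∃ v : ℤ → Lp ℝ 2 (volume.restrict (Set.Ioc (-Real.pi) Real.pi)), HasSpectrum S v := by
  have hle : -Real.pi ≤ Real.pi := by linarith [Real.pi_pos]
  set ν := volume.restrict (Set.Ioc (-Real.pi) Real.pi) with hν
  have hSi : Integrable S ν := (intervalIntegrable_iff_integrableOn_Ioc_of_le hle).1 hS.integrable
  have hmem : ∀ᵐ θ ∂ν, θ ∈ Set.Icc (-Real.pi) Real.pi :=
    (ae_restrict_mem measurableSet_Ioc).mono fun θ hθ => Set.Ioc_subset_Icc_self hθ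
  -- Using cos + sin keeps the vectors real: the product at times s and t gives cos((t-s)θ) +
  -- sin((t+s)θ), and the sine integrates to zero against the even S.
  set f : ℤ → ℝ → ℝ := fun t θ => Real.sqrt (1 / (2 * Real.pi)) * Real.sqrt (S θ)
    * (Real.cos (t * θ) + Real.sin (t * θ)) with hf
  have hcont : ∀ t : ℤ, Continuous fun θ : ℝ => Real.cos (t * θ) + Real.sin (t * θ) := fun t => by
    fun_prop
  have hfm : ∀ t, AEStronglyMeasurable (f t) ν := fun t =>
    ((Real.continuous_sqrt.comp_aestronglyMeasurable hSi.1).const_mul _).mul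
      (hcont t).aestronglyMeasurable
  have hprod : ∀ s t : ℤ, (fun θ => f s θ * f t θ) =ᵐ[ν] fun θ => (1 / (2 * Real.pi)) *
      (S θ * Real.cos (((t : ℝ) - s) * θ) + S θ * Real.sin (((t : ℝ) + s) * θ)) := by
    intro s t
    filter_upwards [hmem] with θ hθ
    have h1 := Real.mul_self_sqrt (hS.nonneg θ hθ)
    have h2 := Real.mul_self_sqrt (by positivity : 0 ≤ 1 / (2 * Real.pi))
    have h3 : (Real.cos (s * θ) + Real.sin (s * θ)) * (Real.cos (t * θ) + Real.sin (t * θ))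
        = Real.cos (((t : ℝ) - s) * θ) + Real.sin (((t : ℝ) + s) * θ) := by
      rw [show ((t : ℝ) - s) * θ = t * θ - s * θ by ring,
        show ((t : ℝ) + s) * θ = t * θ + s * θ by ring, Real.cos_sub, Real.sin_add]
      ring
    calc f s θ * f t θ = (Real.sqrt (1 / (2 * Real.pi)) * Real.sqrt (1 / (2 * Real.pi)))
          * (Real.sqrt (S θ) * Real.sqrt (S θ))
          * ((Real.cos (s * θ) + Real.sin (s * θ)) * (Real.cos (t * θ) + Real.sin (t * θ))) := by
          simp only [hf]; ring
      _ = _ := by rw [h1, h2, h3]; ring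
  have hcos : ∀ c : ℝ, IntervalIntegrable (fun θ => S θ * Real.cos (c * θ)) volume
      (-Real.pi) Real.pi := fun c =>
    hS.integrable.mul_continuousOn (by fun_prop : Continuous fun θ => Real.cos (c * θ)).continuousOn
  have hsin : ∀ c : ℝ, IntervalIntegrable (fun θ => S θ * Real.sin (c * θ)) volume
      (-Real.pi) Real.pi := fun c =>
    hS.integrable.mul_continuousOn (by fun_prop : Continuous fun θ => Real.sin (c * θ)).continuousOn
  have hodd : ∀ c : ℝ, ∫ θ in (-Real.pi)..Real.pi, S θ * Real.sin (c * θ) = 0 := by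
    intro c
    have h1 := intervalIntegral.integral_comp_neg (a := -Real.pi) (b := Real.pi)
      fun θ => S θ * Real.sin (c * θ)
    rw [neg_neg] at h1
    have h2 : ∫ θ in (-Real.pi)..Real.pi, S (-θ) * Real.sin (c * -θ)
        = ∫ θ in (-Real.pi)..Real.pi, -(S θ * Real.sin (c * θ)) := by
      refine intervalIntegral.integral_congr fun θ hθ => ?_
      rw [Set.uIcc_of_le hle] at hθ
      rw [hS.even θ hθ, mul_neg, Real.sin_neg, mul_neg]
    rw [h2, intervalIntegral.integral_neg] at h1
    linarith
  have hfL : ∀ t, MemLp (f t) 2 ν := by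
    intro t
    rw [memLp_two_iff_integrable_sq (hfm t)]
    simp_rw [sq]
    refine Integrable.congr ?_ (hprod t t).symm
    exact (((intervalIntegrable_iff_integrableOn_Ioc_of_le hle).1 (hcos _)).add
      ((intervalIntegrable_iff_integrableOn_Ioc_of_le hle).1 (hsin _))).const_mul _
  refine ⟨fun t => (hfL t).toLp (f t), fun s t => ?_⟩
  rw [inner_toLp, integral_congr_ae (hprod s t), integral_const_mul, hν,
    ← intervalIntegral.integral_of_le hle, intervalIntegral.integral_add (hcos _) (hsin _), hodd,
    add_zero]

variable {Ω : Type*} [MeasurableSpace Ω] {μ : Measure Ω}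

lemma lpSeq_coe {T : Type*} (x : T → Lp ℝ 2 μ) : lpSeq (fun t => Lp.memLp (x t)) = x :=
  funext fun t => Lp.toLp_coeFn (x t) _

/-- Existence of the output of a stable filter driven by a stationary process. -/
lemma exists_isOutput {G : RatFunc ℝ} (hG : IsRHInfty G) {S : ℝ → ℝ} {x : ℤ → Lp ℝ 2 μ}
    (hx : HasSpectrum S x) :
    ∃ y : ℤ → Lp ℝ 2 μ, IsOutput G (fun t => ⇑(x t)) (fun t => ⇑(y t)) μ := by
  obtain ⟨g, hg⟩ := hG.exists_isImpulseResponse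
  have hnorm : ∀ t, ‖x t‖ ≤ ‖x 0‖ := by
    intro t
    refine le_of_eq ((sq_eq_sq₀ (norm_nonneg _) (norm_nonneg _)).1 ?_)
    rw [← real_inner_self_eq_norm_sq, ← real_inner_self_eq_norm_sq, hx, hx]
    simp
  -- Stationarity makes the norms constant, so absolute summability of g suffices.
  have hsum : ∀ t : ℤ, Summable fun k : ℕ => g k • x (t - k) := by
    intro t
    refine Summable.of_norm_bounded (hg.summable.mul_right ‖x 0‖) fun k => ?_
    rw [norm_smul, Real.norm_eq_abs]
    gcongr
    exact hnorm _
  refine ⟨fun t => ∑' k : ℕ, g k • x (t - k), fun t => (Lp.stronglyMeasurable _).measurable,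
    g, hg, fun t => ?_⟩
  refine (tendsto_toLp (f := fun N => ∑ k ∈ Finset.range N, g k • x (t - k)) (fun N => ?_)
    (Lp.memLp _)).1 ?_
  · have := toLp_sum_smul (fun k : ℕ => Lp.memLp (x (t - k))) (Finset.range N) g
    simpa only [Lp.toLp_coeFn] using this
  · rw [Lp.toLp_coeFn]
    exact (hsum t).hasSum.tendsto_sum_nat

/-- Existence of the closed loop. -/
theorem exists_isClosedLoop {H Kv K : RatFunc ℝ} {Sv : ℝ → ℝ} (hH : IsRHInfty H)
    (hK : IsStabilizing 1 Kv K) (hSv : IsPSD Sv) :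
    ∃ (Ω : Type) (_ : MeasurableSpace Ω) (μ : Measure Ω) (_ : IsProbabilityMeasure μ)
      (W V U Y : ℤ → Ω → ℝ), IsClosedLoop H Kv K Sv W V U Y μ := by
  classical
  have hQ : IsRHInfty (K / (1 - K)) := by simpa using hK.w_to_u
  have hQv : IsRHInfty (Kv / (1 - K)) := by simpa using hK.v_to_u
  obtain ⟨v₀, hv₀⟩ := hSv.exists_hasSpectrum
  -- The first summand carries V, the second the white noise, one coordinate vector of ℓ² per time;
  -- orthogonality becomes independence in the Gaussian space.
  obtain ⟨Ω, mΩ, μ, hμ, Φ, hΦ⟩ := exists_gaussian_isometry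
    (WithLp 2 (Lp ℝ 2 (volume.restrict (Set.Ioc (-Real.pi) Real.pi)) × lp (fun _ : ℤ => ℝ) 2))
  set v : ℤ → Lp ℝ 2 μ := fun t => Φ (WithLp.toLp 2 (v₀ t, 0)) with hv
  set z : ℤ → Lp ℝ 2 μ := fun t => Φ (WithLp.toLp 2 (0, lp.single 2 t 1)) with hz
  have hrange : ∀ f ∈ LinearMap.range Φ.toLinearMap, IsCentredGaussian f := by
    rintro _ ⟨x, rfl⟩
    exact hΦ x
  have hE := isCentredGaussian_topologicalClosure hrange
  set E := (LinearMap.range Φ.toLinearMap).topologicalClosure with hEdef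
  have hvE : ∀ t, v t ∈ E := fun t => Submodule.le_topologicalClosure _ ⟨_, rfl⟩
  have hzE : ∀ t, z t ∈ E := fun t => Submodule.le_topologicalClosure _ ⟨_, rfl⟩
  have hvS : HasSpectrum Sv v := by
    intro s t
    rw [hv, ← hv₀ s t]
    simp [WithLp.prod_inner_apply]
  have hzz : ∀ s t, inner ℝ (z s) (z t) = if s = t then 1 else 0 := by
    intro s t
    simp [hz, WithLp.prod_inner_apply, lp.inner_single_left, lp.single_apply, Pi.single_apply]
  have hzv : ∀ s t, inner ℝ (z s) (v t) = 0 := by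
    intro s t
    simp [hz, hv, WithLp.prod_inner_apply]
  have hmeas : ∀ f : Lp ℝ 2 μ, Measurable f := fun f => (Lp.stronglyMeasurable f).measurable
  have hgauss : ∀ {T : Type} (x : T → Lp ℝ 2 μ), (∀ t, x t ∈ E) →
      IsGaussianProcess (fun t => ⇑(x t)) μ := fun x hx =>
    isGaussianProcess_of_mem (fun t => Lp.memLp (x t)) hE fun t => by
      rw [Lp.toLp_coeFn]; exact hx t
  have hcov : ∀ f g : Lp ℝ 2 μ, f ∈ E → cov[⇑f, ⇑g; μ] = inner ℝ f g := by
    intro f g hf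
    rw [covariance_eq_sub (Lp.memLp f) (Lp.memLp g), (hE f hf).integral_eq_zero, zero_mul, sub_zero]
    have := inner_toLp (Lp.memLp f) (Lp.memLp g)
    rw [Lp.toLp_coeFn, Lp.toLp_coeFn] at this
    exact this.symm
  have hZ : IsWhiteGaussian (fun t => ⇑(z t)) μ := by
    refine ⟨fun t => hmeas _, fun t => ?_, ?_⟩
    · rw [hE _ (hzE t)]
      congr 1
      have h1 : ‖z t‖ ^ 2 = 1 := by rw [← real_inner_self_eq_norm_sq, hzz, if_pos rfl]
      ext
      simpa using h1
    · have h1 := IsGaussianProcess.iIndepFun_of_covariance_eq_zero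
        (X := fun (t : ℤ) (_ : Unit) => ⇑(z t)) (P := μ)
        (hgauss (fun p : (_ : ℤ) × Unit => z p.1) fun p => hzE _)
        (fun t _ => (hmeas _).aemeasurable) fun s t hst _ _ => by
          rw [hcov _ _ (hzE s), hzz, if_neg hst]
      exact h1.comp (fun _ x => x ()) fun _ => by fun_prop
  have hZL : ∀ t, MemLp (z t) 2 μ := fun t => Lp.memLp _
  have hzS : HasSpectrum (fun _ => 1) z := by
    have := hZ.hasSpectrum
    rwa [show lpSeq hZ.memLp = z from lpSeq_coe z] at this
  obtain ⟨w, hw⟩ := exists_isOutput hH hzS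
  obtain ⟨gw, hgw, hlw⟩ := hw.exists_tendsto (fun t => Lp.memLp (z t)) fun t => Lp.memLp (w t)
  rw [lpSeq_coe, lpSeq_coe] at hlw
  have hwS := hzS.of_isImpulseResponse intervalIntegrable_const hgw hlw
  have hwcl := hw.mem_closure (fun t => Lp.memLp (z t)) fun t => Lp.memLp (w t)
  rw [lpSeq_coe, lpSeq_coe] at hwcl
  have hwE : ∀ t, w t ∈ E := fun t => by
    refine Submodule.topologicalClosure_minimal _ (Submodule.span_le.2 ?_)
      (Submodule.isClosed_topologicalClosure _) (hwcl t)
    rintro _ ⟨s, rfl⟩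
    exact hzE s
  have hwv : ∀ s t, inner ℝ (w s) (v t) = 0 := by
    intro s t
    have h1 : Submodule.span ℝ (Set.range z) ≤ (Submodule.span ℝ {v t})ᗮ := by
      rw [Submodule.span_le]
      rintro _ ⟨r, rfl⟩
      rw [SetLike.mem_coe, Submodule.mem_orthogonal_singleton_iff_inner_left]
      exact hzv r t
    have h2 := Submodule.topologicalClosure_minimal _ h1 (Submodule.isClosed_orthogonal _) (hwcl s)
    exact Submodule.mem_orthogonal_singleton_iff_inner_left.1 h2
  obtain ⟨a, ha⟩ := exists_isOutput hQ hwS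
  obtain ⟨b, hb⟩ := exists_isOutput hQv hvS
  refine ⟨Ω, mΩ, μ, hμ, fun t => w t, fun t => v t, fun t ω => a t ω + b t ω,
    fun t ω => a t ω + b t ω + w t ω, ?_⟩
  refine ⟨fun t => (hmeas _).add (hmeas _), fun t => ((hmeas _).add (hmeas _)).add (hmeas _),
    ⟨fun t => z t, hZ, hw⟩, ⟨fun t => hmeas _, hgauss v hvE,
      fun t => (hE _ (hvE t)).integral_eq_zero, fun s t => ?_⟩, ?_,
    ⟨fun t => a t, fun t => b t, ha, hb, fun t => ae_eq_rfl⟩, fun t => ae_eq_rfl⟩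
  · rw [← hvS s t]
    have := inner_toLp (Lp.memLp (v s)) (Lp.memLp (v t))
    rw [Lp.toLp_coeFn, Lp.toLp_coeFn] at this
    exact this.symm
  · refine IsGaussianProcess.indepFun_of_covariance_eq_zero (X := fun t => ⇑(w t))
      (Y := fun t => ⇑(v t)) ?_ (fun t => (hmeas _).aemeasurable) (fun t => (hmeas _).aemeasurable)
      fun s t => by rw [hcov _ _ (hwE s), hwv]
    have h1 := hgauss (Sum.elim w v) (by rintro (t | t); exacts [hwE t, hvE t])
    have h2 : (fun t => ⇑(Sum.elim w v t) : ℤ ⊕ ℤ → Ω → ℝ)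
        = Sum.elim (fun t => ⇑(w t)) fun t => ⇑(v t) := by
      funext t
      rcases t with t | t <;> rfl
    rwa [h2] at h1

end Existence

/-! ### Equality of the two value sets and finiteness of the supremum -/

section Capacity

variable {H : RatFunc ℝ} {P : ℝ}

lemma isPSD_zero : IsPSD fun _ => 0 :=
  ⟨fun _ _ => le_rfl, fun _ _ => rfl, intervalIntegrable_const⟩

lemma isRHInfty_zero : IsRHInfty 0 :=
  ⟨isStrictlyProper_zero.le, fun z hz => by simp at hz⟩

lemma freqResp_zero (θ : ℝ) : freqResp 0 θ = 0 := by
  simp [freqResp, evalAt]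

lemma freqResp_one (θ : ℝ) : freqResp 1 θ = 1 := by
  simp [freqResp, evalAt]

lemma capacityValues_nonempty (H : RatFunc ℝ) (hP : 0 ≤ P) : (capacityValues H P).Nonempty :=
  ⟨_, fun _ => 0, 0, isPSD_zero, isRHInfty_zero, isStrictlyProper_zero, by
    simpa [inputPower, freqResp_zero] using hP, rfl⟩

/-- The geometric mean of S_y is at most its arithmetic mean (p = 1 in `IsRegularPSD.geomMean_le`),
and |1+Q|² ≤ 2 + 2|Q|² bounds the latter by 2P + 2c, where c is the noise power. -/
lemma bddAbove_capacityValues (hH : IsRHInfty H) (hSw : ∀ θ, 0 < noisePSD H θ) (P : ℝ) :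
    BddAbove (capacityValues H P) := by
  have hπ := Real.pi_pos
  have hle : -Real.pi ≤ Real.pi := by linarith
  set c : ℝ := (1 / (2 * Real.pi)) * ∫ θ in (-Real.pi)..Real.pi, noisePSD H θ with hc
  refine ⟨1 / 2 * Real.logb 2 ((2 * P + 2 * c) / geomMean (noisePSD H)), ?_⟩
  rintro _ ⟨Sv, Q, hSv, hQ, hQ', hp, rfl⟩
  have hreg := isRegularPSD_outputPSD hH hSw hQ hQ' hSv
  have hnoise := (hH.isRegularPSD_noisePSD hSw).integrable
  have hfeed : IntervalIntegrable (fun θ => ‖freqResp Q θ‖ ^ 2 * noisePSD H θ) volume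
      (-Real.pi) Real.pi := integrable_mul_continuous hnoise (hQ.continuous_freqResp.norm.pow 2)
  have hgm : geomMean (outputPSD H Sv Q) ≤ 2 * P + 2 * c := by
    have h1 := hreg.geomMean_le (p := 1) (by simp)
    simp only [circleEval, map_one, norm_one, one_pow, one_mul] at h1
    have h2 : ∫ θ in (-Real.pi)..Real.pi, outputPSD H Sv Q θ ≤
        ∫ θ in (-Real.pi)..Real.pi,
          (2 * (Sv θ + ‖freqResp Q θ‖ ^ 2 * noisePSD H θ) + 2 * noisePSD H θ) := by
      refine intervalIntegral.integral_mono_on hle hreg.integrable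
        (((hSv.integrable.add hfeed).const_mul 2).add (hnoise.const_mul 2)) fun θ hθ => ?_
      have h3 : ‖1 + freqResp Q θ‖ ≤ 1 + ‖freqResp Q θ‖ := by
        simpa using norm_add_le (1 : ℂ) (freqResp Q θ)
      have h4 : ‖1 + freqResp Q θ‖ ^ 2 ≤ 2 + 2 * ‖freqResp Q θ‖ ^ 2 := by
        nlinarith [norm_nonneg (1 + freqResp Q θ), sq_nonneg (1 - ‖freqResp Q θ‖)]
      have h5 := mul_le_mul_of_nonneg_right h4 (hSw θ).le
      have h6 := hSv.nonneg θ hθ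
      rw [outputPSD]
      linarith
    rw [intervalIntegral.integral_add ((hSv.integrable.add hfeed).const_mul 2)
      (hnoise.const_mul 2), intervalIntegral.integral_const_mul,
      intervalIntegral.integral_const_mul] at h2
    have h3 := mul_le_mul_of_nonneg_left h2 (by positivity : 0 ≤ 1 / (2 * Real.pi))
    rw [inputPower] at hp
    rw [hc]
    linarith
  rw [objective_eq hH hSw hQ hQ' hSv]
  have h1 : 0 < geomMean (outputPSD H Sv Q) := Real.exp_pos _
  have h2 : 0 < geomMean (noisePSD H) := Real.exp_pos _
  have h3 := Real.logb_le_logb_of_le one_lt_two (by positivity)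
    (div_le_div_of_nonneg_right hgm h2.le)
  linarith

/-- The achievable directed information rates are the values of the objective at the feasible
points. -/
theorem directedInfoRates_eq_capacityValues (hH : IsRHInfty H) (hSw : ∀ θ, 0 < noisePSD H θ)
    (P : ℝ) : directedInfoRates H P = capacityValues H P := by
  ext R
  constructor
  · rintro ⟨Kv, K, Sv, hK, hK', hSv, Ω, _, μ, _, W, V, U, Y, hcl, ⟨p, hp, hpow⟩, hR⟩
    obtain ⟨h1, h2⟩ := hcl.hasRate hH hSw hK hK' hSv
    have hQv : IsRHInfty (Kv / (1 - K)) := by simpa using hK.v_to_u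
    -- The feedforward filter is absorbed into the density |Qv|² S_v; uniqueness of limits
    -- identifies the given rate and power with the computed ones.
    exact ⟨_, _, hQv.isPSD_mul hSv, by simpa using hK.w_to_u, hK'.div_one_sub,
      (tendsto_nhds_unique h2.2 hpow.2).trans_le hp, tendsto_nhds_unique hR.2 h1.2⟩
  · rintro ⟨Sv, Q, hSv, hQ, hQ', hp, rfl⟩
    -- With feedforward Youla parameter 1, the exogenous input itself has the prescribed density.
    have hK := isStabilizing_youla hQ hQ'
    obtain ⟨Ω, mΩ, μ, hμ, W, V, U, Y, hcl⟩ := exists_isClosedLoop hH hK hSv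
    obtain ⟨h1, h2⟩ := hcl.hasRate hH hSw hK hQ'.div_one_add hSv
    simp only [youla_feedback hQ', youla_feedforward hQ', freqResp_one, norm_one, one_pow,
      one_mul] at h1 h2
    exact ⟨_, _, Sv, hK, hQ'.div_one_add, hSv, Ω, mΩ, μ, hμ, W, V, U, Y, hcl, ⟨_, hp, h2⟩, h1⟩

end Capacity

end FeedbackCapacity

theorem mainTheorem4 (H : RatFunc ℝ) (hH : FeedbackCapacity.IsRHInfty H)
    (hSw : ∀ θ : ℝ, 0 < FeedbackCapacity.noisePSD H θ) (P : ℝ) (hP : 0 ≤ P) :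
    (∀ (Kv K : RatFunc ℝ) (Sv : ℝ → ℝ), FeedbackCapacity.IsStabilizing 1 Kv K →
      FeedbackCapacity.IsStrictlyProper K → FeedbackCapacity.IsPSD Sv →
      ∃ R p : ℝ, ∀ (Ω : Type) [MeasurableSpace Ω] (μ : Measure Ω) [IsProbabilityMeasure μ]
        (W V U Y : ℤ → Ω → ℝ), FeedbackCapacity.IsClosedLoop H Kv K Sv W V U Y μ →
        FeedbackCapacity.HasDirectedInfoRate U Y μ R ∧
          FeedbackCapacity.HasAveragePower U μ p) ∧
    ∃ C : ℝ, IsLUB (FeedbackCapacity.directedInfoRates H P) C ∧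
      IsLUB (FeedbackCapacity.capacityValues H P) C ∧
      (C ∈ FeedbackCapacity.directedInfoRates H P ↔
        C ∈ FeedbackCapacity.capacityValues H P) := by
  refine ⟨fun Kv K Sv hK hK' hSv => ⟨_, _, fun Ω _ μ _ W V U Y h => h.hasRate hH hSw hK hK' hSv⟩,
    ?_⟩
  have hLUB := isLUB_csSup (FeedbackCapacity.capacityValues_nonempty H hP)
    (FeedbackCapacity.bddAbove_capacityValues hH hSw P)
  -- The sets of values coincide, so supremum and attainment are shared.
  rw [FeedbackCapacity.directedInfoRates_eq_capacityValues hH hSw P]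
  exact ⟨_, hLUB, hLUB, Iff.rfl⟩
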